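/- \textbf{Theorem (median-adjusted central limit theorem).} Let $Y_1,Y_2,\dots$ be i.i.d. real random variables with common Lebesgue density $f$, and let $g:\mathbb{R}\to\mathbb{R}^L$ be measurable. For $k\ge 1$ put $n=2k+1$, let $Y_{n1}<Y_{n2}<\dots<Y_{nn}$ be the ordered sample of $Y_1,\dots,Y_n$ (there are almost surely no ties), and let $m_k:=Y_{n,k+1}$ be the sample median. Assume that (a) $f$ is of class $C^1(\mathbb{R})$, the distribution of $Y_1$ has a unique median $\gamma$, $f(\gamma)>0$, and there are a constant $\varepsilon_0>0$ and a Lebesgue integrable function $\zeta$ such that $$\sup_{|a|\le\varepsilon_0}|f'(y+a)|\le\frac{\zeta(y)}{1+|g(y-\gamma)|^3},\qquad y\in\mathbb{R};$$ (b) $\int|g(y-\gamma)|^3f(y)\,dy<\infty$. Put $$G_k:=\frac1{2k}\sum_{1\le j\le 2k+1,\ j\ne k+1}g(Y_{nj}-m_k),\qquad \rho:=\int g(y-\gamma)f(y)\,dy,$$ $$D:=\int g(y-\gamma)f'(y)\,dy,\qquad H:=\int_\gamma^\infty g(y-\gamma)f(y)\,dy-\int_{-\infty}^\gamma g(y-\gamma)f(y)\,dy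 .$$ Then all the integrals here and below converge absolutely, and, as $k\to\infty$, $$\bigl(\sqrt{2k}\,(G_k-\rho),\ \sqrt{2k}\,(m_k-\gamma)\bigr)\longrightarrow N_{L+1}(0,\Sigma)\quad\text{in distribution},\qquad \Sigma=\begin{pmatrix}\Sigma_{11}&\Sigma_{12}\\ \Sigma_{12}^\top&\Sigma_{22}\end{pmatrix},$$ where $\Sigma$ is the positive semidefinite matrix with blocks $$\Sigma_{11}=\int\{g(y-\gamma)-\rho\}\{g(y-\gamma)-\rho\}^\top f(y)\,dy+\frac{1}{4f(\gamma)^2}DD^\top+\frac{1}{2f(\gamma)}\bigl(DH^\top+HD^\top\bigr),$$ $$\Sigma_{12}=\frac{1}{2f(\gamma)}H+\frac1{4f(\gamma)^2}D,\qquad \Sigma_{22}=\frac1{4f(\gamma)^2}.$$ -/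

import Mathlib

open MeasureTheory ProbabilityTheory Filter Topology

noncomputable section

namespace MedianCLT

/-- The distribution on `ℝ` with Lebesgue density `f`. -/
def densityLaw (f : ℝ → ℝ) : Measure ℝ :=
  volume.withDensity fun y => ENNReal.ofReal (f y)

/-- `c` is a median of the distribution `μ` on `ℝ`. -/
def IsMedian (μ : Measure ℝ) (c : ℝ) : Prop :=
  1 / 2 ≤ μ (Set.Iic c) ∧ 1 / 2 ≤ μ (Set.Ici c)

/-- The ordered sample: the entries of `y` rearranged in increasing order. -/
def orderStat {n : ℕ} (y : Fin n → ℝ) : Fin n → ℝ :=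
  y ∘ Tuple.sort y

/-- The position of the median in an ordered sample of size `2k+1`
(the `(k+1)`-st position, counted from one). -/
def medianIndex (k : ℕ) : Fin (2 * k + 1) :=
  ⟨k, by omega⟩

/-- The sample median `m_k` of a sample of odd size `2k+1`. -/
def sampleMedian (k : ℕ) (y : Fin (2 * k + 1) → ℝ) : ℝ :=
  orderStat y (medianIndex k)

variable {L : ℕ}

/-- The statistic `G_k`: the mean of `g (Y_{nj} - m_k)` over the `2k` order statistics
other than the sample median. -/
def medianAdjustedMean (g : ℝ → EuclideanSpace ℝ (Fin L)) (k : ℕ)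
    (y : Fin (2 * k + 1) → ℝ) : EuclideanSpace ℝ (Fin L) :=
  (1 / (2 * (k : ℝ))) •
    ∑ j : Fin (2 * k + 1) with j ≠ medianIndex k, g (orderStat y j - sampleMedian k y)

/-- `ρ = ∫ g(y - γ) f(y) dy`. -/
def rho (f : ℝ → ℝ) (g : ℝ → EuclideanSpace ℝ (Fin L)) (γ : ℝ) : EuclideanSpace ℝ (Fin L) :=
  ∫ y, f y • g (y - γ)

/-- `∫ g(y - γ) f'(y) dy`. -/
def derivTerm (f : ℝ → ℝ) (g : ℝ → EuclideanSpace ℝ (Fin L)) (γ : ℝ) :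
    EuclideanSpace ℝ (Fin L) :=
  ∫ y, deriv f y • g (y - γ)

/-- `∫_γ^∞ g(y - γ) f(y) dy - ∫_{-∞}^γ g(y - γ) f(y) dy`. -/
def halfDiff (f : ℝ → ℝ) (g : ℝ → EuclideanSpace ℝ (Fin L)) (γ : ℝ) :
    EuclideanSpace ℝ (Fin L) :=
  (∫ y in Set.Ioi γ, f y • g (y - γ)) - ∫ y in Set.Iio γ, f y • g (y - γ)

/-- The block `Σ₁₁`; the mixed term is the symmetrised outer product. -/
def Sigma11 (f : ℝ → ℝ) (g : ℝ → EuclideanSpace ℝ (Fin L)) (γ : ℝ) :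
    Matrix (Fin L) (Fin L) ℝ :=
  Matrix.of fun i j =>
    (∫ y, (g (y - γ) i - rho f g γ i) * (g (y - γ) j - rho f g γ j) * f y)
      + 1 / (4 * f γ ^ 2) * (derivTerm f g γ i * derivTerm f g γ j)
      + 1 / (2 * f γ) *
        (derivTerm f g γ i * halfDiff f g γ j + halfDiff f g γ i * derivTerm f g γ j)

/-- The block `Σ₁₂`, a column. -/
def Sigma12 (f : ℝ → ℝ) (g : ℝ → EuclideanSpace ℝ (Fin L)) (γ : ℝ) :
    Matrix (Fin L) Unit ℝ :=
  Matrix.of fun i _ =>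
    1 / (2 * f γ) * halfDiff f g γ i + 1 / (4 * f γ ^ 2) * derivTerm f g γ i

/-- The block `Σ₂₂`. -/
def Sigma22 (f : ℝ → ℝ) (γ : ℝ) : Matrix Unit Unit ℝ :=
  Matrix.of fun _ _ => 1 / (4 * f γ ^ 2)

/-- The asymptotic covariance matrix `Σ`, of size `L + 1`. -/
def asympCov (f : ℝ → ℝ) (g : ℝ → EuclideanSpace ℝ (Fin L)) (γ : ℝ) :
    Matrix (Fin L ⊕ Unit) (Fin L ⊕ Unit) ℝ :=
  Matrix.fromBlocks (Sigma11 f g γ) (Sigma12 f g γ) (Sigma12 f g γ).transpose (Sigma22 f γ)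

/-- The `(L+1)`-dimensional vector `(√(2k) (G_k - ρ), √(2k) (m_k - γ))` computed from
the sample `y` of size `2k+1`. -/
def normalizedPair (f : ℝ → ℝ) (g : ℝ → EuclideanSpace ℝ (Fin L)) (γ : ℝ) (k : ℕ)
    (y : Fin (2 * k + 1) → ℝ) : EuclideanSpace ℝ (Fin L ⊕ Unit) :=
  WithLp.toLp 2 (Sum.elim
    (fun l => √(2 * (k : ℝ)) * (medianAdjustedMean g k y l - rho f g γ l))
    (fun _ => √(2 * (k : ℝ)) * (sampleMedian k y - γ)))

end MedianCLT

end

noncomputable section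

namespace MedianCLT

/-! ### Combinatorics and measurability of the ordered sample -/

lemma sampleMedian_eq_apply (k : ℕ) (y : Fin (2 * k + 1) → ℝ) :
    sampleMedian k y = y (Tuple.sort y (medianIndex k)) := rfl

lemma sampleMedian_le_iff (k : ℕ) (y : Fin (2 * k + 1) → ℝ) (c : ℝ) :
    sampleMedian k y ≤ c ↔ k < (Finset.univ.filter fun j => y j ≤ c).card := by
  have h := Tuple.lt_card_le_iff_apply_le_of_monotone (j := medianIndex k) (a := c)
    (Tuple.monotone_sort y)
  rw [sampleMedian_eq_apply]
  change _ ↔ ((medianIndex k : Fin (2 * k + 1)) : ℕ) < _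
  rw [← Function.comp_apply (f := y), ← h]
  have : (Finset.univ.filter fun j => y j ≤ c).card
      = (Finset.univ.filter fun j => (y ∘ Tuple.sort y) j ≤ c).card := by
    symm
    refine Finset.card_equiv (Tuple.sort y) fun i => ?_
    simp
  rw [this]

lemma measurable_sampleMedian (k : ℕ) : Measurable (sampleMedian k) := by
  refine measurable_of_Iic fun c => ?_
  have : sampleMedian k ⁻¹' Set.Iic c
      = {y | k < ∑ j : Fin (2 * k + 1), if y j ≤ c then 1 else 0} := by
    ext y
    simp only [Set.mem_preimage, Set.mem_Iic, Set.mem_ofPred_eq]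
    rw [sampleMedian_le_iff, Finset.card_filter]
  rw [this]
  refine measurableSet_lt measurable_const (Finset.measurable_sum _ fun j _ => ?_)
  exact Measurable.ite (measurableSet_le (measurable_pi_apply j) measurable_const)
    measurable_const measurable_const

/-- A product over the ordered sample without its median, indexed by the sample itself. -/
@[to_additive /-- A sum over the ordered sample without its median, indexed by the sample
itself. -/]
lemma prod_orderStat_ne_median {M : Type*} [CommMonoid M] (k : ℕ) (y : Fin (2 * k + 1) → ℝ)
    (F : ℝ → M) :
    ∏ j : Fin (2 * k + 1) with j ≠ medianIndex k, F (orderStat y j)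
      = ∏ j : Fin (2 * k), F (y ((Tuple.sort y (medianIndex k)).succAbove j)) := by
  have h1 : ∏ j : Fin (2 * k + 1) with j ≠ medianIndex k, F (orderStat y j)
      = ∏ j : Fin (2 * k + 1) with j ≠ Tuple.sort y (medianIndex k), F (y j) := by
    refine Finset.prod_equiv (Tuple.sort y) (fun i => ?_) (fun i _ => rfl)
    simp
  have h2 : (Finset.univ.filter fun j => j ≠ Tuple.sort y (medianIndex k))
      = Finset.univ.image (Tuple.sort y (medianIndex k)).succAbove := by
    rw [Fin.image_succAbove_univ]
    ext; simp
  rw [h1, h2, Finset.prod_image fun a _ b _ h => Fin.succAbove_right_injective h]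

lemma measurable_medianAdjustedMean {L : ℕ} {g : ℝ → EuclideanSpace ℝ (Fin L)}
    (hg : Measurable g) (k : ℕ) : Measurable (medianAdjustedMean g k) := by
  have : medianAdjustedMean g k = fun y => (1 / (2 * (k : ℝ))) •
      (∑ j, g (y j - sampleMedian k y) - g 0) := by
    funext y
    have h := sum_orderStat_ne_median k y fun z => g (z - sampleMedian k y)
    rw [medianAdjustedMean, h, Fin.sum_univ_succAbove _ (Tuple.sort y (medianIndex k)),
      ← sampleMedian_eq_apply k y, sub_self, add_sub_cancel_left]
  rw [this]
  have := measurable_sampleMedian k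
  fun_prop

lemma card_filter_lt_sort {n : ℕ} {y : Fin n → ℝ} (hy : Function.Injective y) (p : Fin n) :
    (Finset.univ.filter fun j => y j < y (Tuple.sort y p)).card = p := by
  have hmono : StrictMono (y ∘ Tuple.sort y) :=
    (Tuple.monotone_sort y).strictMono_of_injective (hy.comp (Tuple.sort y).injective)
  have : (Finset.univ.filter fun j => y j < y (Tuple.sort y p)).card
      = (Finset.univ.filter fun j => j < p).card := by
    symm
    refine Finset.card_equiv (Tuple.sort y) fun i => ?_
    have := hmono.lt_iff_lt (a := i) (b := p)
    simp only [Function.comp_apply] at this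
    simp [this]
  rw [this, show (Finset.univ.filter fun j => j < p) = Finset.Iio p by ext; simp, Fin.card_Iio]

/-- The value `h (z - m)` for `z` below `m`, zero otherwise. -/
def belowPart (h : ℝ → ℂ) (m z : ℝ) : ℂ := if z < m then h (z - m) else 0

/-- The value `h (z - m)` for `z` above `m`, zero otherwise. -/
def abovePart (h : ℝ → ℂ) (m z : ℝ) : ℂ := if m < z then h (z - m) else 0

/-- Sum over all choices of the median and of the set of entries below it. -/
lemma prod_median_eq_sum {k : ℕ} {y : Fin (2 * k + 1) → ℝ} (hy : Function.Injective y)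
    (e h : ℝ → ℂ) :
    e (sampleMedian k y) *
        ∏ j : Fin (2 * k + 1) with j ≠ medianIndex k, h (orderStat y j - sampleMedian k y)
      = ∑ i : Fin (2 * k + 1), ∑ S ∈ Finset.powersetCard k (Finset.univ : Finset (Fin (2 * k))),
          e (y i) * ∏ j : Fin (2 * k), if j ∈ S then belowPart h (y i) (y (i.succAbove j))
            else abovePart h (y i) (y (i.succAbove j)) := by
  set i₀ := Tuple.sort y (medianIndex k) with hi₀
  have hcard : ∀ i : Fin (2 * k + 1), (Finset.univ.filter fun j : Fin (2 * k) =>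
      y (i.succAbove j) < y i).card = (Finset.univ.filter fun j => y j < y i).card := by
    intro i
    rw [Finset.card_filter, Finset.card_filter, Fin.sum_univ_succAbove _ i]
    simp
  have hS : ∀ (i : Fin (2 * k + 1)) (S : Finset (Fin (2 * k))),
      (∏ j : Fin (2 * k), if j ∈ S then belowPart h (y i) (y (i.succAbove j))
            else abovePart h (y i) (y (i.succAbove j))) ≠ 0 →
      S = Finset.univ.filter fun j : Fin (2 * k) => y (i.succAbove j) < y i := by
    intro i S hne
    rw [Finset.prod_ne_zero_iff] at hne
    ext j
    have hj := hne j (Finset.mem_univ j)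
    simp only [Finset.mem_filter, Finset.mem_univ, true_and]
    constructor
    · intro hjS
      by_contra hlt
      simp [hjS, belowPart, hlt] at hj
    · intro hlt
      by_contra hjS
      simp [hjS, abovePart, hlt.le.not_gt] at hj
  have hne : ∀ i j, y (i.succAbove j) ≠ y i := fun i j h => Fin.succAbove_ne i j (hy h)
  set S₀ := Finset.univ.filter fun j : Fin (2 * k) => y (i₀.succAbove j) < y i₀ with hS₀
  have hS₀card : S₀.card = k := by
    rw [hS₀, hcard, hi₀, card_filter_lt_sort hy]
    rfl
  rw [Finset.sum_eq_single i₀]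
  · rw [Finset.sum_eq_single S₀]
    · rw [prod_orderStat_ne_median k y fun z => h (z - sampleMedian k y), sampleMedian_eq_apply,
        ← hi₀]
      congr 1
      refine Finset.prod_congr rfl fun j _ => ?_
      by_cases hj : y (i₀.succAbove j) < y i₀
      · rw [if_pos (by simpa [hS₀] using hj), belowPart, if_pos hj]
      · rw [if_neg (by simpa [hS₀] using hj), abovePart,
          if_pos (lt_of_le_of_ne (not_lt.1 hj) (hne i₀ j).symm)]
    · intro S _ hSne
      by_contra hprod
      exact hSne (hS i₀ S (right_ne_zero_of_mul hprod))
    · intro hnot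
      exact absurd (Finset.mem_powersetCard.2 ⟨Finset.subset_univ _, hS₀card⟩) hnot
  · intro i _ hi
    refine Finset.sum_eq_zero fun S hSmem => ?_
    by_contra hprod
    have h1 := hS i S (right_ne_zero_of_mul hprod)
    have h2 := (Finset.mem_powersetCard.1 hSmem).2
    obtain ⟨p, rfl⟩ := (Tuple.sort y).surjective i
    rw [h1, hcard, card_filter_lt_sort hy] at h2
    refine hi ?_
    rw [hi₀]
    congr 1
    exact Fin.ext h2
  · simp

/-! ### The exact integral formula -/

section Integral

variable (μ : Measure ℝ) [IsProbabilityMeasure μ]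

lemma ae_injective_pi [NullSingletonClass μ] (n : ℕ) :
    ∀ᵐ y ∂(Measure.pi fun _ : Fin n => μ), Function.Injective y := by
  have hpair : ∀ i j : Fin n, i ≠ j → ∀ᵐ y ∂(Measure.pi fun _ : Fin n => μ), y i ≠ y j := by
    intro i j hij
    obtain _ | n := n
    · exact i.elim0
    obtain ⟨j', rfl⟩ := Fin.exists_succAbove_eq hij.symm
    have hmp := measurePreserving_piFinSuccAbove (fun _ : Fin (n + 1) => μ) i
    have hprod : ∀ᵐ q ∂(μ.prod (Measure.pi fun _ : Fin n => μ)), q.1 ≠ q.2 j' := by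
      have hms : MeasurableSet {q : ℝ × (Fin n → ℝ) | q.1 ≠ q.2 j'} := by
        refine (measurableSet_eq_fun ?_ ?_).compl <;> fun_prop
      rw [Measure.ae_prod_iff_ae_ae hms]
      refine Eventually.of_forall fun x => ?_
      rw [ae_iff]
      simpa [eq_comm] using Measure.pi_hyperplane (fun _ : Fin n => μ) j' x
    exact hmp.quasiMeasurePreserving.ae hprod
  have hall : ∀ᵐ y ∂(Measure.pi fun _ : Fin n => μ), ∀ i j : Fin n, i ≠ j → y i ≠ y j := by
    rw [ae_all_iff]; intro i
    rw [ae_all_iff]; intro j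
    by_cases hij : i = j
    · simp [hij]
    · filter_upwards [hpair i j hij] with y hy _ using hy
  filter_upwards [hall] with y hy i j hij
  by_contra hne
  exact hy i j hne hij

variable {e h : ℝ → ℂ}

lemma measurable_belowPart (hh : Measurable h) :
    Measurable fun q : ℝ × ℝ => belowPart h q.1 q.2 :=
  Measurable.ite (measurableSet_lt measurable_snd measurable_fst) (by fun_prop) measurable_const

lemma measurable_abovePart (hh : Measurable h) :
    Measurable fun q : ℝ × ℝ => abovePart h q.1 q.2 :=
  Measurable.ite (measurableSet_lt measurable_fst measurable_snd) (by fun_prop) measurable_const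

lemma norm_belowPart_le (hh : ∀ z, ‖h z‖ ≤ 1) (m z : ℝ) : ‖belowPart h m z‖ ≤ 1 := by
  unfold belowPart; split_ifs <;> simp [hh]

lemma norm_abovePart_le (hh : ∀ z, ‖h z‖ ≤ 1) (m z : ℝ) : ‖abovePart h m z‖ ≤ 1 := by
  unfold abovePart; split_ifs <;> simp [hh]

lemma integrable_and_integral_split (he : Measurable e) (hh : Measurable h)
    (he1 : ∀ z, ‖e z‖ ≤ 1) (hh1 : ∀ z, ‖h z‖ ≤ 1) (k : ℕ) (i : Fin (2 * k + 1))
    (S : Finset (Fin (2 * k))) (hS : S.card = k) :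
    Integrable (fun y : Fin (2 * k + 1) → ℝ => e (y i) * ∏ j : Fin (2 * k),
        if j ∈ S then belowPart h (y i) (y (i.succAbove j))
          else abovePart h (y i) (y (i.succAbove j))) (Measure.pi fun _ => μ) ∧
    ∫ y : Fin (2 * k + 1) → ℝ, (e (y i) * ∏ j : Fin (2 * k),
        if j ∈ S then belowPart h (y i) (y (i.succAbove j))
          else abovePart h (y i) (y (i.succAbove j))) ∂(Measure.pi fun _ => μ)
      = ∫ m, e m * ((∫ z, belowPart h m z ∂μ) ^ k * (∫ z, abovePart h m z ∂μ) ^ k) ∂μ := by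
  set c : Fin (2 * k) → ℝ → ℝ → ℂ := fun j m z =>
    if j ∈ S then belowPart h m z else abovePart h m z with hc
  have hcm : ∀ j, Measurable fun q : ℝ × ℝ => c j q.1 q.2 := by
    intro j
    by_cases hj : j ∈ S
    · simpa [hc, hj] using measurable_belowPart hh
    · simpa [hc, hj] using measurable_abovePart hh
  have hc1 : ∀ j m z, ‖c j m z‖ ≤ 1 := by
    intro j m z
    by_cases hj : j ∈ S
    · simpa [hc, hj] using norm_belowPart_le hh1 m z
    · simpa [hc, hj] using norm_abovePart_le hh1 m z
  let G : ℝ × (Fin (2 * k) → ℝ) → ℂ := fun q => e q.1 * ∏ j, c j q.1 (q.2 j)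
  have hGm : Measurable G := by
    refine (he.comp measurable_fst).mul (Finset.measurable_prod _ fun j _ => ?_)
    exact (hcm j).comp (measurable_fst.prodMk ((measurable_pi_apply j).comp measurable_snd))
  have hG1 : ∀ q, ‖G q‖ ≤ 1 := by
    intro q
    rw [norm_mul, norm_prod]
    exact mul_le_one₀ (he1 _) (Finset.prod_nonneg fun _ _ => norm_nonneg _)
      (Finset.prod_le_one (fun _ _ => norm_nonneg _) fun j _ => hc1 j _ _)
  have hGi : Integrable G (μ.prod (Measure.pi fun _ : Fin (2 * k) => μ)) :=
    Integrable.of_bound hGm.aestronglyMeasurable 1 (Eventually.of_forall hG1)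
  have hmp := measurePreserving_piFinSuccAbove (fun _ : Fin (2 * k + 1) => μ) i
  refine ⟨hmp.integrable_comp_of_integrable hGi, ?_⟩
  refine (hmp.integral_comp' G).trans ?_
  rw [integral_prod G hGi]
  refine integral_congr_ae (Eventually.of_forall fun m => ?_)
  simp only [G]
  rw [integral_const_mul, integral_fintype_prod_eq_prod (fun j z => c j m z)]
  congr 1
  have : ∀ j, ∫ z, c j m z ∂μ
      = if j ∈ S then ∫ z, belowPart h m z ∂μ else ∫ z, abovePart h m z ∂μ := by
    intro j
    by_cases hj : j ∈ S <;> simp [hc, hj]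
  simp_rw [this]
  rw [Finset.prod_ite, Finset.prod_const, Finset.prod_const, Finset.filter_mem_eq_inter,
    Finset.univ_inter, hS, Finset.filter_not, Finset.filter_mem_eq_inter, Finset.univ_inter,
    ← Finset.compl_eq_univ_sdiff, Finset.card_compl, hS, Fintype.card_fin]
  congr 2
  omega

lemma integral_median_prod [NullSingletonClass μ] (he : Measurable e) (hh : Measurable h)
    (he1 : ∀ z, ‖e z‖ ≤ 1) (hh1 : ∀ z, ‖h z‖ ≤ 1) (k : ℕ) :
    ∫ y : Fin (2 * k + 1) → ℝ, (e (sampleMedian k y) *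
        ∏ j : Fin (2 * k + 1) with j ≠ medianIndex k, h (orderStat y j - sampleMedian k y))
          ∂(Measure.pi fun _ => μ)
      = ((2 * k + 1 : ℕ) * (2 * k).choose k : ℂ) *
        ∫ m, e m * ((∫ z, belowPart h m z ∂μ) ^ k * (∫ z, abovePart h m z ∂μ) ^ k) ∂μ := by
  have h1 : ∫ y : Fin (2 * k + 1) → ℝ, (e (sampleMedian k y) *
        ∏ j : Fin (2 * k + 1) with j ≠ medianIndex k, h (orderStat y j - sampleMedian k y))
          ∂(Measure.pi fun _ => μ)
      = ∫ y, (∑ i : Fin (2 * k + 1),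
          ∑ S ∈ Finset.powersetCard k (Finset.univ : Finset (Fin (2 * k))),
          e (y i) * ∏ j : Fin (2 * k), if j ∈ S then belowPart h (y i) (y (i.succAbove j))
            else abovePart h (y i) (y (i.succAbove j))) ∂(Measure.pi fun _ => μ) := by
    refine integral_congr_ae ?_
    filter_upwards [ae_injective_pi μ (2 * k + 1)] with y hy using prod_median_eq_sum hy e h
  have hsplit := fun (i : Fin (2 * k + 1)) (S : Finset (Fin (2 * k)))
    (hS : S ∈ Finset.powersetCard k (Finset.univ : Finset (Fin (2 * k)))) =>
    integrable_and_integral_split μ he hh he1 hh1 k i S (Finset.mem_powersetCard.1 hS).2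
  rw [h1, integral_finsetSum _ fun i _ => integrable_finsetSum _ fun S hS => (hsplit i S hS).1]
  have h2 : ∀ i : Fin (2 * k + 1), ∫ y : Fin (2 * k + 1) → ℝ,
        (∑ S ∈ Finset.powersetCard k (Finset.univ : Finset (Fin (2 * k))),
          e (y i) * ∏ j : Fin (2 * k), if j ∈ S then belowPart h (y i) (y (i.succAbove j))
            else abovePart h (y i) (y (i.succAbove j))) ∂(Measure.pi fun _ => μ)
      = ((2 * k).choose k : ℂ) *
        ∫ m, e m * ((∫ z, belowPart h m z ∂μ) ^ k * (∫ z, abovePart h m z ∂μ) ^ k) ∂μ := by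
    intro i
    rw [integral_finsetSum _ fun S hS => (hsplit i S hS).1,
      Finset.sum_congr rfl fun S hS => (hsplit i S hS).2]
    simp
  simp_rw [h2]
  simp [mul_assoc]

end Integral

/-! ### Expansion of the characteristic integrals -/

/-- A continuously differentiable probability density `p` with median `0` and positive at `0`,
together with a statistic `φ` centred under `p`; increments of `p` are dominated by `ζ`
up to distance `ε`, also after multiplication by `φ`. -/
structure IsCenteredModel (p φ ζ : ℝ → ℝ) (ε : ℝ) : Prop where
  nonneg : ∀ z, 0 ≤ p z
  contDiff : ContDiff ℝ 1 p
  pos : 0 < p 0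
  integrable : Integrable p
  integral_Iic : ∫ z in Set.Iic 0, p z = 1 / 2
  integral_Ioi : ∫ z in Set.Ioi 0, p z = 1 / 2
  measurable : Measurable φ
  eps_pos : 0 < ε
  integrable_bound : Integrable ζ
  bound : ∀ z a, |a| ≤ ε → |deriv p (z + a)| ≤ ζ z
  bound_mul : ∀ z a, |a| ≤ ε → |φ z| * |deriv p (z + a)| ≤ ζ z
  integrable_sq : Integrable fun z => φ z ^ 2 * p z
  centered : ∫ z, φ z * p z = 0

/-- The function `z ↦ exp (i s φ z)`. -/
def expI (φ : ℝ → ℝ) (s z : ℝ) : ℂ := Complex.exp (Complex.I * ((s * φ z : ℝ) : ℂ))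

lemma norm_expI (φ : ℝ → ℝ) (s z : ℝ) : ‖expI φ s z‖ = 1 := by
  rw [expI, Complex.norm_exp_I_mul_ofReal]

lemma measurable_expI {φ : ℝ → ℝ} (hφ : Measurable φ) (s : ℝ) : Measurable (expI φ s) := by
  unfold expI; fun_prop

lemma norm_expI_sub_one_le (φ : ℝ → ℝ) (s z : ℝ) : ‖expI φ s z - 1‖ ≤ |s| * |φ z| := by
  rw [← abs_mul]
  exact Real.norm_exp_I_mul_ofReal_sub_one_le

lemma norm_exp_I_sub_one_sub_le (x : ℝ) :
    ‖Complex.exp (Complex.I * x) - 1 - Complex.I * x‖ ≤ 3 * x ^ 2 := by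
  have hn : ‖Complex.I * (x : ℂ)‖ = |x| := by simp
  rcases le_total |x| 1 with h | h
  · have := Complex.norm_exp_sub_one_sub_id_le (hn.trans_le h)
    rw [hn, sq_abs] at this
    nlinarith [sq_nonneg x]
  · have h1 := norm_sub_le (Complex.exp (Complex.I * x) - 1) (Complex.I * x)
    have h2 := Real.norm_exp_I_mul_ofReal_sub_one_le (x := x)
    rw [Real.norm_eq_abs] at h2
    rw [hn] at h1
    nlinarith [sq_abs x]

lemma tendsto_expI_sub_one_div (φ : ℝ → ℝ) (z : ℝ) :
    Tendsto (fun s : ℝ => (expI φ s z - 1) / s) (𝓝[≠] 0) (𝓝 (Complex.I * φ z)) := by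
  have h : HasDerivAt (fun s : ℝ => expI φ s z) (Complex.I * φ z) 0 := by
    have h1 : HasDerivAt (fun s : ℝ => Complex.I * ((s * φ z : ℝ) : ℂ)) (Complex.I * φ z) 0 := by
      have := ((hasDerivAt_id (0 : ℝ)).mul_const (φ z)).ofReal_comp.const_mul Complex.I
      simpa using this
    simpa [expI] using h1.cexp
  rw [hasDerivAt_iff_tendsto_slope_zero] at h
  refine h.congr fun s => ?_
  simp [expI, div_eq_inv_mul]

lemma tendsto_expI_sub_one_sub_div (φ : ℝ → ℝ) (z : ℝ) :
    Tendsto (fun s : ℝ => (expI φ s z - 1 - Complex.I * ((s * φ z : ℝ) : ℂ)) / s ^ 2) (𝓝[≠] 0)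
      (𝓝 (-((φ z ^ 2 : ℝ) : ℂ) / 2)) := by
  have hlin : Tendsto (fun s : ℝ => Complex.I * ((s * φ z : ℝ) : ℂ)) (𝓝[≠] 0) (𝓝 0) := by
    have : Continuous fun s : ℝ => Complex.I * ((s * φ z : ℝ) : ℂ) := by fun_prop
    simpa using (this.tendsto 0).mono_left nhdsWithin_le_nhds
  have hO := (Complex.exp_sub_sum_range_isBigO_pow 3).comp_tendsto hlin
  have ho : (fun s : ℝ => (Complex.I * ((s * φ z : ℝ) : ℂ)) ^ 3)
      =o[𝓝[≠] 0] fun s : ℝ => (s : ℂ) ^ 2 := by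
    refine Asymptotics.isLittleO_of_tendsto' ?_ ?_
    · filter_upwards [self_mem_nhdsWithin] with s hs h0
      simp_all
    · have : Tendsto (fun s : ℝ => (Complex.I * φ z) ^ 3 * (s : ℂ)) (𝓝[≠] 0) (𝓝 0) := by
        have : Continuous fun s : ℝ => (Complex.I * φ z) ^ 3 * (s : ℂ) := by fun_prop
        simpa using (this.tendsto 0).mono_left nhdsWithin_le_nhds
      refine this.congr' ?_
      filter_upwards [self_mem_nhdsWithin] with s hs
      have hs' : (s : ℂ) ≠ 0 := by exact_mod_cast hs
      push_cast
      field_simp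
  have hlim := ((hO.trans_isLittleO ho).tendsto_div_nhds_zero).add_const (-((φ z ^ 2 : ℝ) : ℂ) / 2)
  rw [zero_add] at hlim
  refine hlim.congr' ?_
  filter_upwards [self_mem_nhdsWithin] with s hs
  have hs' : (s : ℂ) ≠ 0 := by exact_mod_cast hs
  simp only [Function.comp_apply, Finset.sum_range_succ, Finset.sum_range_zero, expI]
  push_cast
  simp only [mul_pow, Complex.I_sq]
  field_simp
  simp [Nat.factorial]
  ring

lemma mul_abs_sub_le {p : ℝ → ℝ} (hp : Differentiable ℝ p) {c K ε z x : ℝ} (hc : 0 ≤ c)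
    (hbd : ∀ a, |a| ≤ ε → c * |deriv p (z + a)| ≤ K) (hx : |x| ≤ ε) :
    c * |p (z + x) - p z| ≤ K * |x| := by
  have hε : 0 ≤ ε := (abs_nonneg x).trans hx
  have h := Convex.norm_image_sub_le_of_norm_deriv_le (𝕜 := ℝ) (f := fun y => c * p y)
    (s := Metric.closedBall z ε) (x := z) (y := z + x) (C := K)
    (fun y _ => (hp y).const_mul c) (fun y hy => ?_) (convex_closedBall z ε)
    (Metric.mem_closedBall_self hε) (by simpa [Metric.mem_closedBall, Real.dist_eq] using hx)
  · simpa [← mul_sub, abs_mul, abs_of_nonneg hc] using h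
  · have hy' : |y - z| ≤ ε := by simpa [Real.dist_eq] using hy
    have := hbd (y - z) hy'
    rw [add_sub_cancel] at this
    rw [deriv_const_mul _ (hp y), norm_mul, Real.norm_eq_abs, Real.norm_eq_abs, abs_of_nonneg hc]
    exact this

lemma tendsto_incr_div {p : ℝ → ℝ} (hp : Differentiable ℝ p) (z t : ℝ) :
    Tendsto (fun s : ℝ => (((p (z + s * t) - p z) / s : ℝ) : ℂ)) (𝓝[≠] 0)
      (𝓝 ((t * deriv p z : ℝ) : ℂ)) := by
  refine (Complex.continuous_ofReal.tendsto _).comp ?_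
  have h : HasDerivAt (fun s : ℝ => p (z + s * t)) (t * deriv p z) 0 := by
    have h1 : HasDerivAt (fun s : ℝ => z + s * t) t 0 := by
      simpa using ((hasDerivAt_id (0 : ℝ)).mul_const t).const_add z
    have h2 : HasDerivAt p (deriv p z) (z + 0 * t) := by simpa using (hp z).hasDerivAt
    have h3 := h2.comp 0 h1
    rw [mul_comm] at h3
    exact h3
  rw [hasDerivAt_iff_tendsto_slope_zero] at h
  refine h.congr fun s => ?_
  simp [div_eq_inv_mul]

namespace IsCenteredModel

variable {p φ ζ : ℝ → ℝ} {ε : ℝ}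

lemma differentiable (H : IsCenteredModel p φ ζ ε) : Differentiable ℝ p :=
  H.contDiff.differentiable (by norm_num)

lemma continuous (H : IsCenteredModel p φ ζ ε) : Continuous p := H.contDiff.continuous

lemma continuous_deriv (H : IsCenteredModel p φ ζ ε) : Continuous (deriv p) :=
  H.contDiff.continuous_deriv (by norm_num)

lemma integral_eq_one (H : IsCenteredModel p φ ζ ε) : ∫ z, p z = 1 := by
  rw [← intervalIntegral.integral_Iic_add_Ioi (b := 0) H.integrable.integrableOn
    H.integrable.integrableOn, H.integral_Iic, H.integral_Ioi]
  norm_num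

lemma abs_sub_le (H : IsCenteredModel p φ ζ ε) {x : ℝ} (hx : |x| ≤ ε) (z : ℝ) :
    |p (z + x) - p z| ≤ ζ z * |x| := by
  simpa using mul_abs_sub_le H.differentiable zero_le_one
    (fun a ha => by simpa using H.bound z a ha) hx

lemma mul_abs_sub_le (H : IsCenteredModel p φ ζ ε) {x : ℝ} (hx : |x| ≤ ε) (z : ℝ) :
    |φ z| * |p (z + x) - p z| ≤ ζ z * |x| :=
  MedianCLT.mul_abs_sub_le H.differentiable (abs_nonneg _) (fun a ha => H.bound_mul z a ha) hx

lemma integrable_deriv (H : IsCenteredModel p φ ζ ε) : Integrable (deriv p) := by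
  refine H.integrable_bound.mono' H.continuous_deriv.aestronglyMeasurable
    (Eventually.of_forall fun z => ?_)
  simpa using H.bound z 0 (by simpa using H.eps_pos.le)

lemma integrable_mul_deriv (H : IsCenteredModel p φ ζ ε) :
    Integrable fun z => φ z * deriv p z := by
  refine H.integrable_bound.mono'
    (H.measurable.mul H.continuous_deriv.measurable).aestronglyMeasurable
    (Eventually.of_forall fun z => ?_)
  simpa using H.bound_mul z 0 (by simpa using H.eps_pos.le)

lemma integrable_abs_mul (H : IsCenteredModel p φ ζ ε) : Integrable fun z => |φ z| * p z := by
  refine (H.integrable_sq.add H.integrable).mono'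
    (H.measurable.abs.mul H.continuous.measurable).aestronglyMeasurable
    (Eventually.of_forall fun z => ?_)
  rw [Real.norm_eq_abs, abs_mul, abs_abs, abs_of_nonneg (H.nonneg z), Pi.add_apply]
  nlinarith [sq_nonneg (|φ z| - 1), sq_abs (φ z), H.nonneg z, abs_nonneg (φ z),
    mul_nonneg (add_nonneg (sq_nonneg (|φ z| - 1)) (abs_nonneg (φ z))) (H.nonneg z)]

lemma integrable_mul (H : IsCenteredModel p φ ζ ε) : Integrable fun z => φ z * p z := by
  refine H.integrable_abs_mul.mono'
    (H.measurable.mul H.continuous.measurable).aestronglyMeasurable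
    (Eventually.of_forall fun z => ?_)
  rw [Real.norm_eq_abs, abs_mul, abs_of_nonneg (H.nonneg z)]

lemma integral_deriv_Iic (H : IsCenteredModel p φ ζ ε) : ∫ z in Set.Iic 0, deriv p z = p 0 := by
  have hd : ∀ x, HasDerivAt p (deriv p x) x := fun x => (H.differentiable x).hasDerivAt
  have h0 := tendsto_zero_of_hasDerivAt_of_integrableOn_Iic (a := 0) (fun x _ => hd x)
    H.integrable_deriv.integrableOn H.integrable.integrableOn
  rw [integral_Iic_of_hasDerivAt_of_tendsto' (fun x _ => hd x)
    H.integrable_deriv.integrableOn h0, sub_zero]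

lemma integral_deriv_Ioi (H : IsCenteredModel p φ ζ ε) :
    ∫ z in Set.Ioi 0, deriv p z = -p 0 := by
  have hd : ∀ x, HasDerivAt p (deriv p x) x := fun x => (H.differentiable x).hasDerivAt
  have h0 := tendsto_zero_of_hasDerivAt_of_integrableOn_Ioi (a := 0) (fun x _ => hd x)
    H.integrable_deriv.integrableOn H.integrable.integrableOn
  rw [integral_Ioi_of_hasDerivAt_of_tendsto' (fun x _ => hd x)
    H.integrable_deriv.integrableOn h0, zero_sub]

lemma eventually_abs_mul_le (H : IsCenteredModel p φ ζ ε) (t : ℝ) :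
    ∀ᶠ s : ℝ in 𝓝[≠] 0, s ≠ 0 ∧ |s * t| ≤ ε := by
  have h1 : Tendsto (fun s : ℝ => |s * t|) (𝓝[≠] 0) (𝓝 0) := by
    have : Continuous fun s : ℝ => |s * t| := by fun_prop
    simpa using (this.tendsto 0).mono_left nhdsWithin_le_nhds
  filter_upwards [self_mem_nhdsWithin, h1.eventually_le_const H.eps_pos] with s hs hs'
    using ⟨hs, hs'⟩

lemma integrable_expI_mul (H : IsCenteredModel p φ ζ ε) (s x : ℝ) :
    Integrable fun z => expI φ s z * p (z + x) := by
  refine (H.integrable.comp_add_right x).mono' ?_ (Eventually.of_forall fun z => ?_)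
  · exact ((measurable_expI H.measurable s).mul
      (Complex.measurable_ofReal.comp (H.continuous.measurable.comp
        (measurable_id.add_const x)))).aestronglyMeasurable
  · simp [norm_expI, abs_of_nonneg (H.nonneg _)]

/-- Second order expansion of the characteristic function of `φ` under the shifted density. -/
lemma tendsto_integral_expI (H : IsCenteredModel p φ ζ ε) (t : ℝ) :
    Tendsto (fun s : ℝ => ((∫ z, expI φ s z * p (z + s * t)) - 1) / s ^ 2) (𝓝[≠] 0)
      (𝓝 (Complex.I * t * ((∫ z, φ z * deriv p z : ℝ) : ℂ)
        - ((∫ z, φ z ^ 2 * p z : ℝ) : ℂ) / 2)) := by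
  have hlim : Tendsto (fun s : ℝ => ∫ z, ((expI φ s z - 1) / s *
        (((p (z + s * t) - p z) / s : ℝ) : ℂ) +
        (expI φ s z - 1 - Complex.I * ((s * φ z : ℝ) : ℂ)) / s ^ 2 * p z)) (𝓝[≠] 0)
      (𝓝 (∫ z, (Complex.I * φ z * ((t * deriv p z : ℝ) : ℂ)
        + -((φ z ^ 2 : ℝ) : ℂ) / 2 * p z))) := by
    refine tendsto_integral_filter_of_dominated_convergence
      (fun z => |t| * ζ z + 3 * (φ z ^ 2 * p z)) ?_ ?_ ?_ ?_
    · refine Eventually.of_forall fun s => Measurable.aestronglyMeasurable ?_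
      have h1 := measurable_expI H.measurable s
      have h2 := H.measurable
      have h3 := H.continuous.measurable
      fun_prop
    · filter_upwards [H.eventually_abs_mul_le t] with s ⟨hs, hst⟩
      refine Eventually.of_forall fun z => (norm_add_le _ _).trans (add_le_add ?_ ?_)
      · rw [norm_mul, norm_div, Complex.norm_real, Complex.norm_real, Real.norm_eq_abs,
          Real.norm_eq_abs, abs_div]
        have hs' : 0 < |s| := abs_pos.2 hs
        have h1 := norm_expI_sub_one_le φ s z
        have h2 := H.mul_abs_sub_le hst z
        rw [abs_mul] at h2
        rw [div_mul_div_comm, div_le_iff₀ (by positivity)]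
        nlinarith [abs_nonneg (p (z + s * t) - p z),
          mul_le_mul_of_nonneg_right h1 (abs_nonneg (p (z + s * t) - p z))]
      · have h1 := norm_exp_I_sub_one_sub_le (s * φ z)
        rw [norm_mul, norm_div, norm_pow, Complex.norm_real, Complex.norm_real,
          Real.norm_of_nonneg (H.nonneg z), Real.norm_eq_abs, sq_abs, ← mul_assoc]
        refine mul_le_mul_of_nonneg_right ?_ (H.nonneg z)
        rw [div_le_iff₀ (by positivity)]
        calc _ ≤ _ := h1
          _ = _ := by ring
    · exact (H.integrable_bound.const_mul _).add (H.integrable_sq.const_mul 3)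
    · refine Eventually.of_forall fun z => ?_
      exact ((tendsto_expI_sub_one_div φ z).mul (tendsto_incr_div H.differentiable z t)).add
        ((tendsto_expI_sub_one_sub_div φ z).mul_const _)
  have hval : (∫ z, (Complex.I * φ z * ((t * deriv p z : ℝ) : ℂ)
        + -((φ z ^ 2 : ℝ) : ℂ) / 2 * p z))
      = Complex.I * t * ((∫ z, φ z * deriv p z : ℝ) : ℂ)
        - ((∫ z, φ z ^ 2 * p z : ℝ) : ℂ) / 2 := by
    have h1 : ∀ z, (Complex.I * φ z * ((t * deriv p z : ℝ) : ℂ)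
        + -((φ z ^ 2 : ℝ) : ℂ) / 2 * p z) = Complex.I * t * ((φ z * deriv p z : ℝ) : ℂ)
          + (-1 / 2) * ((φ z ^ 2 * p z : ℝ) : ℂ) := by
      intro z; push_cast; ring
    simp_rw [h1]
    rw [integral_add (H.integrable_mul_deriv.ofReal.const_mul _)
      (H.integrable_sq.ofReal.const_mul _), integral_const_mul, integral_const_mul,
      integral_complex_ofReal, integral_complex_ofReal]
    ring
  rw [hval] at hlim
  refine hlim.congr' ?_
  filter_upwards [self_mem_nhdsWithin] with s hs
  have hs' : (s : ℂ) ≠ 0 := by exact_mod_cast hs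
  have h1 : ∀ z, ((expI φ s z - 1) / s * (((p (z + s * t) - p z) / s : ℝ) : ℂ) +
        (expI φ s z - 1 - Complex.I * ((s * φ z : ℝ) : ℂ)) / s ^ 2 * p z)
      = (expI φ s z * p (z + s * t) - ((p (z + s * t) : ℝ) : ℂ)
          - Complex.I * s * ((φ z * p z : ℝ) : ℂ)) / s ^ 2 := by
    intro z; push_cast; field_simp; ring
  have h2 : Integrable fun z => ((p (z + s * t) : ℝ) : ℂ) :=
    (H.integrable.comp_add_right (s * t)).ofReal
  have h3 : Integrable fun z => Complex.I * s * ((φ z * p z : ℝ) : ℂ) :=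
    H.integrable_mul.ofReal.const_mul _
  have h4 := H.integrable_expI_mul s (s * t)
  have h5 : Integrable fun z => expI φ s z * p (z + s * t) - ((p (z + s * t) : ℝ) : ℂ) :=
    h4.sub h2
  simp_rw [h1]
  rw [integral_div, integral_sub h5 h3, integral_sub h4 h2, integral_const_mul,
    integral_complex_ofReal, integral_complex_ofReal, H.centered,
    integral_add_right_eq_self p (s * t), H.integral_eq_one]
  simp

end IsCenteredModel

/-- The sign of `z`, with value `-1` at zero. -/
def halfSign (z : ℝ) : ℝ := if 0 < z then 1 else -1

lemma measurable_halfSign : Measurable halfSign :=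
  Measurable.ite measurableSet_Ioi measurable_const measurable_const

lemma abs_halfSign (z : ℝ) : |halfSign z| = 1 := by
  unfold halfSign; split_ifs <;> simp

lemma integrable_halfSign_mul {q : ℝ → ℝ} (hq : Integrable q) :
    Integrable fun z => halfSign z * q z := by
  refine hq.norm.mono' (measurable_halfSign.aestronglyMeasurable.mul hq.aestronglyMeasurable)
    (Eventually.of_forall fun z => ?_)
  rw [norm_mul, Real.norm_eq_abs, abs_halfSign, one_mul]

lemma integral_halfSign_mul {q : ℝ → ℝ} (hq : Integrable q) :
    ∫ z, halfSign z * q z = (∫ z in Set.Ioi 0, q z) - ∫ z in Set.Iic 0, q z := by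
  have hi := integrable_halfSign_mul hq
  rw [← intervalIntegral.integral_Iic_add_Ioi (b := 0) hi.integrableOn hi.integrableOn,
    setIntegral_congr_fun (g := fun z => -q z) measurableSet_Iic,
    setIntegral_congr_fun (g := q) measurableSet_Ioi, integral_neg]
  · ring
  · intro z hz
    simp [halfSign, Set.mem_Ioi.1 hz]
  · intro z hz
    simp [halfSign, not_lt.2 (Set.mem_Iic.1 hz)]

namespace IsCenteredModel

variable {p φ ζ : ℝ → ℝ} {ε : ℝ}

/-- First order expansion of the signed characteristic integral. -/
lemma tendsto_integral_halfSign_expI (H : IsCenteredModel p φ ζ ε) (t : ℝ) :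
    Tendsto (fun s : ℝ => (∫ z, halfSign z * (expI φ s z * p (z + s * t))) / s) (𝓝[≠] 0)
      (𝓝 (Complex.I * ((∫ z, halfSign z * (φ z * p z) : ℝ) : ℂ) - 2 * t * p 0)) := by
  have hE : ∀ z, Tendsto (fun s : ℝ => expI φ s z) (𝓝[≠] 0) (𝓝 1) := by
    intro z
    have : Continuous fun s : ℝ => expI φ s z := by unfold expI; fun_prop
    simpa [expI] using (this.tendsto 0).mono_left nhdsWithin_le_nhds
  have hlim : Tendsto (fun s : ℝ => ∫ z, (halfSign z : ℂ) * (expI φ s z *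
        (((p (z + s * t) - p z) / s : ℝ) : ℂ) + (expI φ s z - 1) / s * p z)) (𝓝[≠] 0)
      (𝓝 (∫ z, (halfSign z : ℂ) * (1 * ((t * deriv p z : ℝ) : ℂ)
        + Complex.I * φ z * p z))) := by
    refine tendsto_integral_filter_of_dominated_convergence
      (fun z => |t| * ζ z + |φ z| * p z) ?_ ?_ ?_ ?_
    · refine Eventually.of_forall fun s => Measurable.aestronglyMeasurable ?_
      have h1 := measurable_expI H.measurable s
      have h2 := H.measurable
      have h3 := H.continuous.measurable
      have h4 := measurable_halfSign
      fun_prop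
    · filter_upwards [H.eventually_abs_mul_le t] with s ⟨hs, hst⟩
      refine Eventually.of_forall fun z => ?_
      have hs' : 0 < |s| := abs_pos.2 hs
      rw [norm_mul, Complex.norm_real, Real.norm_eq_abs, abs_halfSign, one_mul]
      refine (norm_add_le _ _).trans (add_le_add ?_ ?_)
      · have h2 := H.abs_sub_le hst z
        rw [abs_mul] at h2
        rw [norm_mul, norm_expI, one_mul, Complex.norm_real, Real.norm_eq_abs, abs_div,
          div_le_iff₀ hs']
        linarith
      · rw [norm_mul, norm_div, Complex.norm_real, Complex.norm_real, Real.norm_eq_abs,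
          Real.norm_of_nonneg (H.nonneg z)]
        refine mul_le_mul_of_nonneg_right ?_ (H.nonneg z)
        rw [div_le_iff₀ hs']
        linarith [norm_expI_sub_one_le φ s z]
    · exact (H.integrable_bound.const_mul _).add H.integrable_abs_mul
    · refine Eventually.of_forall fun z => ?_
      exact (((hE z).mul (tendsto_incr_div H.differentiable z t)).add
        ((tendsto_expI_sub_one_div φ z).mul_const _)).const_mul _
  have hval : (∫ z, (halfSign z : ℂ) * (1 * ((t * deriv p z : ℝ) : ℂ)
        + Complex.I * φ z * p z))
      = Complex.I * ((∫ z, halfSign z * (φ z * p z) : ℝ) : ℂ) - 2 * t * p 0 := by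
    have h1 : ∀ z, (halfSign z : ℂ) * (1 * ((t * deriv p z : ℝ) : ℂ) + Complex.I * φ z * p z)
        = t * ((halfSign z * deriv p z : ℝ) : ℂ)
          + Complex.I * ((halfSign z * (φ z * p z) : ℝ) : ℂ) := by
      intro z; push_cast; ring
    simp_rw [h1]
    rw [integral_add ((integrable_halfSign_mul H.integrable_deriv).ofReal.const_mul _)
      ((integrable_halfSign_mul H.integrable_mul).ofReal.const_mul _), integral_const_mul,
      integral_const_mul, integral_complex_ofReal, integral_complex_ofReal,
      integral_halfSign_mul H.integrable_deriv, H.integral_deriv_Iic, H.integral_deriv_Ioi]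
    push_cast
    ring
  rw [hval] at hlim
  refine hlim.congr' ?_
  filter_upwards [self_mem_nhdsWithin] with s hs
  have hs' : (s : ℂ) ≠ 0 := by exact_mod_cast hs
  have h1 : ∀ z, (halfSign z : ℂ) * (expI φ s z *
        (((p (z + s * t) - p z) / s : ℝ) : ℂ) + (expI φ s z - 1) / s * p z)
      = (halfSign z * (expI φ s z * p (z + s * t)) - ((halfSign z * p z : ℝ) : ℂ)) / s := by
    intro z; push_cast; field_simp; ring
  have h2 : Integrable fun z => (halfSign z : ℂ) * (expI φ s z * p (z + s * t)) := by
    refine (H.integrable_expI_mul s (s * t)).norm.mono'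
      ((Complex.measurable_ofReal.comp measurable_halfSign).aestronglyMeasurable.mul
        (H.integrable_expI_mul s (s * t)).aestronglyMeasurable)
      (Eventually.of_forall fun z => ?_)
    rw [norm_mul, Complex.norm_real, Real.norm_eq_abs, abs_halfSign, one_mul]
  have h3 : Integrable fun z => ((halfSign z * p z : ℝ) : ℂ) :=
    (integrable_halfSign_mul H.integrable).ofReal
  simp_rw [h1]
  rw [integral_div, integral_sub h2 h3,
    integral_complex_ofReal, integral_halfSign_mul H.integrable, H.integral_Iic, H.integral_Ioi]
  simp

end IsCenteredModel

/-! ### The limit of the median integral -/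

/-- The integral of `h` over the negative half-line against the density `p` shifted by `x`. -/
def lowerPart (p : ℝ → ℝ) (h : ℝ → ℂ) (x : ℝ) : ℂ := ∫ z, belowPart h 0 z * p (z + x)

/-- The integral of `h` over the positive half-line against the density `p` shifted by `x`. -/
def upperPart (p : ℝ → ℝ) (h : ℝ → ℂ) (x : ℝ) : ℂ := ∫ z, abovePart h 0 z * p (z + x)

/-- The scaling `1 / √(2k)`. -/
def rate (k : ℕ) : ℝ := (√(2 * (k : ℝ)))⁻¹

lemma rate_sq (k : ℕ) : rate k ^ 2 = (2 * (k : ℝ))⁻¹ := by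
  rw [rate, inv_pow, Real.sq_sqrt (by positivity)]

lemma rate_pos {k : ℕ} (hk : k ≠ 0) : 0 < rate k := by
  unfold rate; positivity

lemma tendsto_rate : Tendsto rate atTop (𝓝[≠] 0) := by
  refine tendsto_nhdsWithin_iff.2 ⟨?_, ?_⟩
  · refine tendsto_inv_atTop_zero.comp (Real.tendsto_sqrt_atTop.comp ?_)
    exact tendsto_natCast_atTop_atTop.const_mul_atTop two_pos
  · filter_upwards [eventually_ne_atTop 0] with k hk using (rate_pos hk).ne'

lemma measurable_lowerPart {p : ℝ → ℝ} {h : ℝ → ℂ} (hp : Measurable p) (hh : Measurable h) :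
    Measurable (lowerPart p h) := by
  have : Measurable fun q : ℝ × ℝ => belowPart h 0 q.2 * p (q.2 + q.1) :=
    ((measurable_belowPart hh).comp (measurable_const.prodMk measurable_snd)).mul (by fun_prop)
  exact (this.stronglyMeasurable.integral_prod_right (f := fun x z =>
    belowPart h 0 z * p (z + x))).measurable

lemma measurable_upperPart {p : ℝ → ℝ} {h : ℝ → ℂ} (hp : Measurable p) (hh : Measurable h) :
    Measurable (upperPart p h) := by
  have : Measurable fun q : ℝ × ℝ => abovePart h 0 q.2 * p (q.2 + q.1) :=
    ((measurable_abovePart hh).comp (measurable_const.prodMk measurable_snd)).mul (by fun_prop)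
  exact (this.stronglyMeasurable.integral_prod_right (f := fun x z =>
    abovePart h 0 z * p (z + x))).measurable

lemma norm_lowerPart_le {p : ℝ → ℝ} {h : ℝ → ℂ} (hp : Integrable p) (hp0 : ∀ z, 0 ≤ p z)
    (hh : ∀ z, ‖h z‖ ≤ 1) (x : ℝ) : ‖lowerPart p h x‖ ≤ ∫ z in Set.Iic x, p z := by
  have hi : Integrable ((Set.Iic x).indicator p) := hp.indicator measurableSet_Iic
  have heq : ∫ z in Set.Iic x, p z = ∫ z, (Set.Iic x).indicator p (z + x) := by
    rw [integral_add_right_eq_self ((Set.Iic x).indicator p) x,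
      integral_indicator measurableSet_Iic]
  rw [heq]
  refine norm_integral_le_of_norm_le (hi.comp_add_right x) (Eventually.of_forall fun z => ?_)
  by_cases hz : z < 0
  · rw [Set.indicator_of_mem (by simpa using hz.le), norm_mul, Complex.norm_real,
      Real.norm_of_nonneg (hp0 _)]
    exact mul_le_of_le_one_left (hp0 _) (norm_belowPart_le hh 0 z)
  · simpa [belowPart, hz] using Set.indicator_nonneg (fun z _ => hp0 z) _

lemma norm_upperPart_le {p : ℝ → ℝ} {h : ℝ → ℂ} (hp : Integrable p) (hp0 : ∀ z, 0 ≤ p z)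
    (hh : ∀ z, ‖h z‖ ≤ 1) (x : ℝ) : ‖upperPart p h x‖ ≤ ∫ z in Set.Ioi x, p z := by
  have hi : Integrable ((Set.Ioi x).indicator p) := hp.indicator measurableSet_Ioi
  have heq : ∫ z in Set.Ioi x, p z = ∫ z, (Set.Ioi x).indicator p (z + x) := by
    rw [integral_add_right_eq_self ((Set.Ioi x).indicator p) x,
      integral_indicator measurableSet_Ioi]
  rw [heq]
  refine norm_integral_le_of_norm_le (hi.comp_add_right x) (Eventually.of_forall fun z => ?_)
  by_cases hz : 0 < z
  · rw [Set.indicator_of_mem (by simpa using hz), norm_mul, Complex.norm_real,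
      Real.norm_of_nonneg (hp0 _)]
    exact mul_le_of_le_one_left (hp0 _) (norm_abovePart_le hh 0 z)
  · simp [abovePart, hz]

/-- The distribution function moves away from `1/2` at least linearly near the median. -/
lemma mul_min_le_abs_cdf_sub {p : ℝ → ℝ} (hp : Integrable p) (hp0 : ∀ z, 0 ≤ p z)
    (hmed : ∫ z in Set.Iic 0, p z = 1 / 2) {c δ : ℝ} (hδ : 0 < δ)
    (hc : ∀ z, |z| ≤ δ → c / 2 ≤ p z) (x : ℝ) :
    c * min |x| δ ≤ |2 * (∫ z in Set.Iic x, p z) - 1| := by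
  have hsub := fun a b : ℝ => intervalIntegral.integral_Iic_sub_Iic (a := a) (b := b)
    hp.integrableOn hp.integrableOn
  have hmono : ∀ a b c' d : ℝ, c' ≤ a → a ≤ b → b ≤ d →
      ∫ z in a..b, p z ≤ ∫ z in c'..d, p z := fun a b c' d h1 h2 h3 =>
    intervalIntegral.integral_mono_interval h1 h2 h3 (Eventually.of_forall hp0)
      hp.intervalIntegrable
  have hconst : ∀ a b : ℝ, a ≤ b → (∀ z ∈ Set.Icc a b, |z| ≤ δ) →
      (b - a) * (c / 2) ≤ ∫ z in a..b, p z := by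
    intro a b hab hz
    rw [← smul_eq_mul, ← intervalIntegral.integral_const]
    exact intervalIntegral.integral_mono_on hab intervalIntegrable_const hp.intervalIntegrable
      fun z hz' => hc z (hz z hz')
  rcases le_total 0 x with hx | hx
  · have h1 := hsub 0 x
    have hm0 : 0 ≤ min x δ := le_min hx hδ.le
    have h2 := hmono 0 (min x δ) 0 x le_rfl hm0 (min_le_left _ _)
    have h3 := hconst 0 (min x δ) hm0 fun z hz => by
      rw [abs_of_nonneg hz.1]; exact hz.2.trans (min_le_right _ _)
    rw [abs_of_nonneg hx]
    refine le_trans ?_ (le_abs_self _)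
    linarith
  · have h1 := hsub x 0
    have hm0 : 0 ≤ min (-x) δ := le_min (neg_nonneg.2 hx) hδ.le
    have hm1 := min_le_left (-x) δ
    have h2 := hmono (-min (-x) δ) 0 x 0 (by linarith) (by linarith) le_rfl
    have h3 := hconst (-min (-x) δ) 0 (by linarith) fun z hz => by
      rw [abs_of_nonpos hz.2]; linarith [hz.1, min_le_right (-x) δ]
    rw [abs_of_nonpos hx]
    refine le_trans ?_ (neg_le_abs _)
    linarith

namespace IsCenteredModel

variable {p φ ζ : ℝ → ℝ} {ε : ℝ}

lemma integrable_belowPart_mul (H : IsCenteredModel p φ ζ ε) (s x : ℝ) :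
    Integrable fun z => belowPart (expI φ s) 0 z * p (z + x) := by
  refine (H.integrable.comp_add_right x).mono' ?_ (Eventually.of_forall fun z => ?_)
  · exact (((measurable_belowPart (measurable_expI H.measurable s)).comp
      (measurable_const.prodMk measurable_id)).mul
      (Complex.measurable_ofReal.comp (H.continuous.measurable.comp
        (measurable_id.add_const x)))).aestronglyMeasurable
  · rw [norm_mul, Complex.norm_real, Real.norm_of_nonneg (H.nonneg _)]
    exact mul_le_of_le_one_left (H.nonneg _)
      (norm_belowPart_le (fun z => (norm_expI φ s z).le) 0 z)

lemma integrable_abovePart_mul (H : IsCenteredModel p φ ζ ε) (s x : ℝ) :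
    Integrable fun z => abovePart (expI φ s) 0 z * p (z + x) := by
  refine (H.integrable.comp_add_right x).mono' ?_ (Eventually.of_forall fun z => ?_)
  · exact (((measurable_abovePart (measurable_expI H.measurable s)).comp
      (measurable_const.prodMk measurable_id)).mul
      (Complex.measurable_ofReal.comp (H.continuous.measurable.comp
        (measurable_id.add_const x)))).aestronglyMeasurable
  · rw [norm_mul, Complex.norm_real, Real.norm_of_nonneg (H.nonneg _)]
    exact mul_le_of_le_one_left (H.nonneg _)
      (norm_abovePart_le (fun z => (norm_expI φ s z).le) 0 z)

lemma lowerPart_add_upperPart (H : IsCenteredModel p φ ζ ε) (s x : ℝ) :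
    lowerPart p (expI φ s) x + upperPart p (expI φ s) x = ∫ z, expI φ s z * p (z + x) := by
  rw [lowerPart, upperPart, ← integral_add (H.integrable_belowPart_mul s x)
    (H.integrable_abovePart_mul s x)]
  refine integral_congr_ae ?_
  filter_upwards [Measure.ae_ne volume (0 : ℝ)] with z hz
  rcases lt_or_gt_of_ne hz with h | h
  · simp [belowPart, abovePart, h, h.le.not_gt]
  · simp [belowPart, abovePart, h, h.le.not_gt]

lemma upperPart_sub_lowerPart (H : IsCenteredModel p φ ζ ε) (s x : ℝ) :
    upperPart p (expI φ s) x - lowerPart p (expI φ s) x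
      = ∫ z, halfSign z * (expI φ s z * p (z + x)) := by
  rw [lowerPart, upperPart, ← integral_sub (H.integrable_abovePart_mul s x)
    (H.integrable_belowPart_mul s x)]
  refine integral_congr_ae ?_
  filter_upwards [Measure.ae_ne volume (0 : ℝ)] with z hz
  rcases lt_or_gt_of_ne hz with h | h
  · simp [belowPart, abovePart, halfSign, h, h.le.not_gt]
  · simp [belowPart, abovePart, halfSign, h, h.le.not_gt]

/-- The pointwise limit of the integrand. -/
lemma tendsto_parts_pow (H : IsCenteredModel p φ ζ ε) (t : ℝ) :
    Tendsto (fun k : ℕ => (4 * (lowerPart p (expI φ (rate k)) (rate k * t) *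
        upperPart p (expI φ (rate k)) (rate k * t))) ^ k) atTop
      (𝓝 (Complex.exp ((Complex.I * t * ((∫ z, φ z * deriv p z : ℝ) : ℂ)
        - ((∫ z, φ z ^ 2 * p z : ℝ) : ℂ) / 2)
        - (Complex.I * ((∫ z, halfSign z * (φ z * p z) : ℝ) : ℂ) - 2 * t * p 0) ^ 2 / 2))) := by
  have hT := H.tendsto_integral_expI t
  have hU := H.tendsto_integral_halfSign_expI t
  set T : ℝ → ℂ := fun s => ∫ z, expI φ s z * p (z + s * t) with hTdef
  set U : ℝ → ℂ := fun s => ∫ z, halfSign z * (expI φ s z * p (z + s * t)) with hUdef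
  set τ := Complex.I * t * ((∫ z, φ z * deriv p z : ℝ) : ℂ)
        - ((∫ z, φ z ^ 2 * p z : ℝ) : ℂ) / 2
  set υ := Complex.I * ((∫ z, halfSign z * (φ z * p z) : ℝ) : ℂ) - 2 * t * p 0
  replace hT : Tendsto (fun s : ℝ => (T s - 1) / (s : ℂ) ^ 2) (𝓝[≠] 0) (𝓝 τ) := hT
  replace hU : Tendsto (fun s : ℝ => U s / (s : ℂ)) (𝓝[≠] 0) (𝓝 υ) := hU
  have hs0 : Tendsto (fun s : ℝ => (s : ℂ) ^ 2) (𝓝[≠] 0) (𝓝 0) := by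
    have : Continuous fun s : ℝ => (s : ℂ) ^ 2 := by fun_prop
    simpa using (this.tendsto 0).mono_left nhdsWithin_le_nhds
  have hT1 : Tendsto T (𝓝[≠] 0) (𝓝 1) := by
    have := (hT.mul hs0).add_const 1
    rw [mul_zero, zero_add] at this
    refine this.congr' ?_
    filter_upwards [self_mem_nhdsWithin] with s hs
    have hs' : (s : ℂ) ≠ 0 := by exact_mod_cast hs
    field_simp
    ring
  have hlim : Tendsto (fun s : ℝ => (T s ^ 2 - U s ^ 2 - 1) / (s : ℂ) ^ 2 / 2) (𝓝[≠] 0)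
      (𝓝 (τ - υ ^ 2 / 2)) := by
    have h1 := (((hT.mul (hT1.add_const 1)).sub (hU.pow 2)).div_const 2)
    have h2 : (τ * (1 + 1) - υ ^ 2) / 2 = τ - υ ^ 2 / 2 := by ring
    rw [h2] at h1
    refine h1.congr' ?_
    filter_upwards [self_mem_nhdsWithin] with s hs
    have hs' : (s : ℂ) ≠ 0 := by exact_mod_cast hs
    field_simp
    ring
  have hk := Complex.tendsto_one_add_pow_exp_of_tendsto
    (g := fun k => T (rate k) ^ 2 - U (rate k) ^ 2 - 1) (t := τ - υ ^ 2 / 2) (by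
      refine (hlim.comp tendsto_rate).congr' ?_
      filter_upwards [eventually_ne_atTop 0] with k hk
      have h1 : ((rate k : ℝ) : ℂ) ^ 2 = (2 * (k : ℂ))⁻¹ := by
        rw [← Complex.ofReal_pow, rate_sq]; push_cast; rfl
      have hk' : (k : ℂ) ≠ 0 := by exact_mod_cast hk
      simp only [Function.comp_apply, h1]
      field_simp)
  refine hk.congr fun k => ?_
  congr 1
  rw [hTdef, hUdef]
  simp only
  rw [← H.lowerPart_add_upperPart, ← H.upperPart_sub_lowerPart]
  ring

end IsCenteredModel

/-- The (normalised) density of the median times the conditional characteristic function of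
the remaining observations, at distance `x` from the median of `p`. -/
def medianIntegrand (p φ : ℝ → ℝ) (v : ℝ) (k : ℕ) (x : ℝ) : ℂ :=
  Complex.exp (Complex.I * ((v * ((rate k)⁻¹ * x) : ℝ) : ℂ)) *
    (4 * (lowerPart p (expI φ (rate k)) x * upperPart p (expI φ (rate k)) x)) ^ k * p x

namespace IsCenteredModel

variable {p φ ζ : ℝ → ℝ} {ε : ℝ}

lemma measurable_medianIntegrand (H : IsCenteredModel p φ ζ ε) (v : ℝ) (k : ℕ) :
    Measurable (medianIntegrand p φ v k) := by
  have h1 := measurable_lowerPart H.continuous.measurable (measurable_expI H.measurable (rate k))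
  have h2 := measurable_upperPart H.continuous.measurable (measurable_expI H.measurable (rate k))
  have h3 := H.continuous.measurable
  unfold medianIntegrand
  fun_prop

lemma exists_near (H : IsCenteredModel p φ ζ ε) :
    ∃ δ > 0, ∀ z, |z| ≤ δ → p 0 / 2 ≤ p z ∧ p z ≤ 2 * p 0 := by
  have h0 := H.pos
  have h1 : ∀ᶠ z in 𝓝 (0 : ℝ), p z ∈ Set.Icc (p 0 / 2) (2 * p 0) :=
    (H.continuous.tendsto 0).eventually (Icc_mem_nhds (by linarith) (by linarith))
  obtain ⟨δ, hδ, h⟩ := Metric.eventually_nhds_iff_ball.1 h1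
  refine ⟨δ / 2, by positivity, fun z hz => h z ?_⟩
  rw [Metric.mem_ball, Real.dist_eq, sub_zero]
  linarith

lemma norm_parts_le (H : IsCenteredModel p φ ζ ε) {δ : ℝ} (hδ : 0 < δ)
    (hnear : ∀ z, |z| ≤ δ → p 0 / 2 ≤ p z) (s x : ℝ) :
    ‖4 * (lowerPart p (expI φ s) x * upperPart p (expI φ s) x)‖
      ≤ 1 - (p 0 * min |x| δ) ^ 2 := by
  have h1 := norm_lowerPart_le H.integrable H.nonneg (fun z => (norm_expI φ s z).le) x
  have h2 := norm_upperPart_le H.integrable H.nonneg (fun z => (norm_expI φ s z).le) x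
  have h3 := mul_min_le_abs_cdf_sub H.integrable H.nonneg H.integral_Iic hδ hnear x
  have h4 : (∫ z in Set.Iic x, p z) + ∫ z in Set.Ioi x, p z = 1 := by
    rw [intervalIntegral.integral_Iic_add_Ioi H.integrable.integrableOn H.integrable.integrableOn,
      H.integral_eq_one]
  have h5 : 0 ≤ p 0 * min |x| δ := mul_nonneg H.pos.le (le_min (abs_nonneg _) hδ.le)
  have h6 := pow_le_pow_left₀ h5 h3 2
  rw [sq_abs] at h6
  rw [norm_mul, norm_mul, Complex.norm_ofNat]
  have h7 := mul_le_mul h1 h2 (norm_nonneg _) ((norm_nonneg _).trans h1)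
  have h8 : ∫ z in Set.Ioi x, p z = 1 - ∫ z in Set.Iic x, p z := by linarith
  rw [h8] at h7
  nlinarith

lemma norm_medianIntegrand_le (H : IsCenteredModel p φ ζ ε) {δ : ℝ} (hδ : 0 < δ)
    (hnear : ∀ z, |z| ≤ δ → p 0 / 2 ≤ p z) (v : ℝ) (k : ℕ) (x : ℝ) :
    ‖medianIntegrand p φ v k x‖ ≤ (1 - (p 0 * min |x| δ) ^ 2) ^ k * p x := by
  rw [medianIntegrand, norm_mul, norm_mul, Complex.norm_exp_I_mul_ofReal, one_mul, norm_pow,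
    Complex.norm_real, Real.norm_of_nonneg (H.nonneg x)]
  exact mul_le_mul_of_nonneg_right
    (pow_le_pow_left₀ (norm_nonneg _) (H.norm_parts_le hδ hnear _ x) k) (H.nonneg x)

lemma tendsto_medianIntegrand (H : IsCenteredModel p φ ζ ε) (v t : ℝ) :
    Tendsto (fun k : ℕ => medianIntegrand p φ v k (rate k * t)) atTop
      (𝓝 (Complex.exp (Complex.I * ((v * t : ℝ) : ℂ)) *
        Complex.exp ((Complex.I * t * ((∫ z, φ z * deriv p z : ℝ) : ℂ)
          - ((∫ z, φ z ^ 2 * p z : ℝ) : ℂ) / 2)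
          - (Complex.I * ((∫ z, halfSign z * (φ z * p z) : ℝ) : ℂ) - 2 * t * p 0) ^ 2 / 2)
        * p 0)) := by
  have hp : Tendsto (fun k : ℕ => ((p (rate k * t) : ℝ) : ℂ)) atTop (𝓝 (p 0)) := by
    have hc : Continuous fun s : ℝ => ((p (s * t) : ℝ) : ℂ) := by
      have := H.continuous
      fun_prop
    have h1 : Tendsto (fun s : ℝ => ((p (s * t) : ℝ) : ℂ)) (𝓝[≠] 0) (𝓝 (p 0)) := by
      simpa using (hc.tendsto 0).mono_left nhdsWithin_le_nhds
    exact h1.comp tendsto_rate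
  refine ((tendsto_const_nhds.mul (H.tendsto_parts_pow t)).mul hp).congr' ?_
  filter_upwards [eventually_ne_atTop 0] with k hk
  rw [medianIntegrand, inv_mul_cancel_left₀ (rate_pos hk).ne']

lemma tendsto_integral_medianIntegrand (H : IsCenteredModel p φ ζ ε) (v : ℝ) :
    Tendsto (fun k : ℕ => ((rate k)⁻¹ : ℂ) * ∫ x, medianIntegrand p φ v k x) atTop
      (𝓝 (∫ t : ℝ, Complex.exp (Complex.I * ((v * t : ℝ) : ℂ)) *
        Complex.exp ((Complex.I * t * ((∫ z, φ z * deriv p z : ℝ) : ℂ)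
          - ((∫ z, φ z ^ 2 * p z : ℝ) : ℂ) / 2)
          - (Complex.I * ((∫ z, halfSign z * (φ z * p z) : ℝ) : ℂ) - 2 * t * p 0) ^ 2 / 2)
        * p 0)) := by
  obtain ⟨δ, hδ, hnear⟩ := H.exists_near
  have hlow : ∀ z, |z| ≤ δ → p 0 / 2 ≤ p z := fun z hz => (hnear z hz).1
  set N : Set ℝ := {x | |x| ≤ δ} with hN
  have hNm : MeasurableSet N := measurableSet_le measurable_norm measurable_const
  have hG := fun k => H.measurable_medianIntegrand v k
  have hone : ∀ x, 0 ≤ 1 - (p 0 * min |x| δ) ^ 2 := fun x =>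
    (norm_nonneg _).trans (H.norm_parts_le hδ hlow 0 x)
  have hGi : ∀ k, Integrable (medianIntegrand p φ v k) := by
    intro k
    refine H.integrable.mono' (hG k).aestronglyMeasurable (Eventually.of_forall fun x => ?_)
    refine (H.norm_medianIntegrand_le hδ hlow v k x).trans
      (mul_le_of_le_one_left (H.nonneg x) (pow_le_one₀ (hone x) ?_))
    linarith [sq_nonneg (p 0 * min |x| δ)]
  have hnearlim : Tendsto (fun k : ℕ => ∫ t, N.indicator (medianIntegrand p φ v k) (rate k * t))
      atTop (𝓝 (∫ t : ℝ, Complex.exp (Complex.I * ((v * t : ℝ) : ℂ)) *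
        Complex.exp ((Complex.I * t * ((∫ z, φ z * deriv p z : ℝ) : ℂ)
          - ((∫ z, φ z ^ 2 * p z : ℝ) : ℂ) / 2)
          - (Complex.I * ((∫ z, halfSign z * (φ z * p z) : ℝ) : ℂ) - 2 * t * p 0) ^ 2 / 2)
        * p 0)) := by
    refine tendsto_integral_filter_of_dominated_convergence
      (fun t => Real.exp (-(p 0 ^ 2 / 2) * t ^ 2) * (2 * p 0)) ?_ ?_ ?_ ?_
    · exact Eventually.of_forall fun k => (((hG k).indicator hNm).comp
        (measurable_const_mul (rate k))).aestronglyMeasurable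
    · filter_upwards [eventually_ne_atTop 0] with k hk
      refine Eventually.of_forall fun t => ?_
      have hpos : 0 ≤ Real.exp (-(p 0 ^ 2 / 2) * t ^ 2) * (2 * p 0) :=
        mul_nonneg (Real.exp_pos _).le (by linarith [H.pos])
      by_cases hx : rate k * t ∈ N
      · rw [Set.indicator_of_mem hx]
        refine (H.norm_medianIntegrand_le hδ hlow v k _).trans
          (mul_le_mul ?_ (hnear _ hx).2 (H.nonneg _) (Real.exp_pos _).le)
        have h1 := pow_le_pow_left₀ (hone (rate k * t)) (Real.one_sub_le_exp_neg _) k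
        refine h1.trans (le_of_eq ?_)
        rw [← Real.exp_nat_mul, min_eq_left (show |rate k * t| ≤ δ from hx), mul_pow, sq_abs,
          mul_pow, rate_sq]
        congr 1
        have hk' : (k : ℝ) ≠ 0 := by exact_mod_cast hk
        field_simp
      · rw [Set.indicator_of_notMem hx, norm_zero]
        exact hpos
    · exact (integrable_exp_neg_mul_sq (by have := H.pos; positivity)).mul_const _
    · refine Eventually.of_forall fun t => (H.tendsto_medianIntegrand v t).congr' ?_
      have h1 : Tendsto (fun s : ℝ => |s * t|) (𝓝[≠] 0) (𝓝 0) := by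
        have : Continuous fun s : ℝ => |s * t| := by fun_prop
        simpa using (this.tendsto 0).mono_left nhdsWithin_le_nhds
      filter_upwards [(h1.comp tendsto_rate).eventually_le_const hδ] with k hk
      rw [Set.indicator_of_mem (show rate k * t ∈ N from hk)]
  have hfarlim : Tendsto (fun k : ℕ => ((rate k)⁻¹ : ℂ) *
      ∫ x, Nᶜ.indicator (medianIntegrand p φ v k) x) atTop (𝓝 0) := by
    set r := 1 - (p 0 * δ) ^ 2 with hr
    have hr0 : 0 ≤ r := by simpa [hr, abs_of_pos hδ] using hone δ
    have hr1 : |r| < 1 := by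
      rw [abs_of_nonneg hr0, hr]
      have := H.pos
      have : 0 < (p 0 * δ) ^ 2 := by positivity
      linarith
    have hpow := (tendsto_pow_const_mul_const_pow_of_abs_lt_one 1 hr1).const_mul 2
    rw [mul_zero] at hpow
    refine squeeze_zero_norm' ?_ hpow
    filter_upwards [eventually_ne_atTop 0] with k hk
    have h1 : ‖∫ x, Nᶜ.indicator (medianIntegrand p φ v k) x‖ ≤ ∫ x, r ^ k * p x := by
      refine norm_integral_le_of_norm_le (H.integrable.const_mul _)
        (Eventually.of_forall fun x => ?_)
      by_cases hx : x ∈ N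
      · rw [Set.indicator_of_notMem (by simpa using hx), norm_zero]
        exact mul_nonneg (pow_nonneg hr0 k) (H.nonneg x)
      · rw [Set.indicator_of_mem (by simpa using hx)]
        have := H.norm_medianIntegrand_le hδ hlow v k x
        rwa [min_eq_right (not_le.1 hx).le] at this
    rw [integral_const_mul, H.integral_eq_one, mul_one] at h1
    have h2 : (rate k)⁻¹ ≤ 2 * k := by
      have hk1 : (1 : ℝ) ≤ k := by exact_mod_cast Nat.one_le_iff_ne_zero.2 hk
      rw [rate, inv_inv, Real.sqrt_le_left (by positivity)]
      nlinarith
    rw [norm_mul, norm_inv, Complex.norm_real, Real.norm_of_nonneg (rate_pos hk).le, pow_one,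
      ← mul_assoc]
    exact mul_le_mul h2 h1 (norm_nonneg _) (by positivity)
  have hsum := hnearlim.add hfarlim
  rw [add_zero] at hsum
  refine hsum.congr' ?_
  filter_upwards [eventually_ne_atTop 0] with k hk
  rw [Measure.integral_comp_mul_left (N.indicator (medianIntegrand p φ v k)) (rate k),
    abs_of_pos (inv_pos.2 (rate_pos hk)), Complex.real_smul, Complex.ofReal_inv, ← mul_add,
    ← integral_add ((hGi k).indicator hNm) ((hGi k).indicator hNm.compl)]
  congr 2
  funext x
  exact congrFun (Set.indicator_self_add_compl N (medianIntegrand p φ v k)) x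

end IsCenteredModel

/-- A Gaussian integral with linear characteristic term. -/
lemma integral_median_gaussian {q : ℝ} (hq : 0 < q) (v d h σ : ℝ) :
    ∫ t : ℝ, Complex.exp (Complex.I * ((v * t : ℝ) : ℂ)) *
        Complex.exp ((Complex.I * t * d - (σ : ℂ) / 2) - (Complex.I * h - 2 * t * q) ^ 2 / 2) * q
      = ((Real.pi / (2 * q ^ 2) : ℂ) ^ (1 / 2 : ℂ) * q) * Complex.exp
        ((-(σ + (v + d) * h / q + (v + d) ^ 2 / (4 * q ^ 2)) / 2 : ℝ) : ℂ) := by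
  have h1 : ∀ t : ℝ, Complex.exp (Complex.I * ((v * t : ℝ) : ℂ)) *
        Complex.exp ((Complex.I * t * d - (σ : ℂ) / 2) - (Complex.I * h - 2 * t * q) ^ 2 / 2)
      = Complex.exp ((-2 * q ^ 2 : ℂ) * (t : ℂ) ^ 2 + (Complex.I * (v + d + 2 * h * q)) * t
        + (-(σ : ℂ) / 2 + h ^ 2 / 2)) := by
    intro t
    rw [← Complex.exp_add]
    congr 1
    push_cast
    linear_combination (-(h : ℂ) ^ 2 / 2) * Complex.I_sq
  have hb : (-2 * q ^ 2 : ℂ).re < 0 := by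
    have : (-2 * q ^ 2 : ℂ) = ((-2 * q ^ 2 : ℝ) : ℂ) := by push_cast; rfl
    rw [this, Complex.ofReal_re]
    nlinarith [pow_pos hq 2]
  have hq' : (q : ℂ) ≠ 0 := by exact_mod_cast hq.ne'
  simp_rw [h1]
  rw [integral_mul_const, integral_cexp_quadratic hb]
  have h2 : (Real.pi : ℂ) / -(-2 * q ^ 2) = Real.pi / (2 * q ^ 2) := by ring
  rw [h2, mul_right_comm]
  congr 2
  push_cast
  rw [mul_pow, Complex.I_sq]
  field_simp
  ring

/-! ### The model of the theorem -/

/-- The assumptions of the theorem on the density `f`, the function `g` and the median `γ`. -/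
structure IsRegularModel {L : ℕ} (f : ℝ → ℝ) (g : ℝ → EuclideanSpace ℝ (Fin L)) (γ ε₀ : ℝ)
    (ζ : ℝ → ℝ) : Prop where
  nonneg : ∀ y, 0 ≤ f y
  isProbabilityMeasure : IsProbabilityMeasure (densityLaw f)
  measurable : Measurable g
  contDiff : ContDiff ℝ 1 f
  isMedian : IsMedian (densityLaw f) γ
  pos : 0 < f γ
  eps_pos : 0 < ε₀
  integrable_bound : Integrable ζ
  bound : ∀ y a : ℝ, |a| ≤ ε₀ → |deriv f (y + a)| ≤ ζ y / (1 + ‖g (y - γ)‖ ^ 3)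
  integrable_cube : Integrable fun y => ‖g (y - γ)‖ ^ 3 * f y

lemma setIntegral_Ioi_add_right {E : Type*} [NormedAddCommGroup E] [NormedSpace ℝ E]
    (F : ℝ → E) (γ : ℝ) : ∫ z in Set.Ioi 0, F (z + γ) = ∫ y in Set.Ioi γ, F y := by
  have h := (measurePreserving_add_right volume γ).setIntegral_preimage_emb
    (MeasurableEquiv.addRight γ).measurableEmbedding F (Set.Ioi γ)
  simpa using h

lemma setIntegral_Iic_add_right {E : Type*} [NormedAddCommGroup E] [NormedSpace ℝ E]
    (F : ℝ → E) (γ : ℝ) : ∫ z in Set.Iic 0, F (z + γ) = ∫ y in Set.Iic γ, F y := by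
  have h := (measurePreserving_add_right volume γ).setIntegral_preimage_emb
    (MeasurableEquiv.addRight γ).measurableEmbedding F (Set.Iic γ)
  simpa using h

lemma integral_densityLaw {E : Type*} [NormedAddCommGroup E] [NormedSpace ℝ E] {f : ℝ → ℝ}
    (hf : Measurable f) (hf0 : ∀ y, 0 ≤ f y) (F : ℝ → E) :
    ∫ y, F y ∂densityLaw f = ∫ y, f y • F y := by
  rw [densityLaw, integral_withDensity_eq_integral_toReal_smul hf.ennreal_ofReal
    (Eventually.of_forall fun _ => ENNReal.ofReal_lt_top)]
  simp_rw [ENNReal.toReal_ofReal (hf0 _)]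

instance nullSingletonClass_densityLaw (f : ℝ → ℝ) : NullSingletonClass (densityLaw f) :=
  ⟨fun x => withDensity_absolutelyContinuous volume _ (measure_singleton x)⟩

/-- The centred linear statistic attached to the functional `ℓ`. -/
def centeredStat {L : ℕ} (f : ℝ → ℝ) (g : ℝ → EuclideanSpace ℝ (Fin L)) (γ : ℝ)
    (ℓ : EuclideanSpace ℝ (Fin L) →L[ℝ] ℝ) (z : ℝ) : ℝ := ℓ (g z - rho f g γ)

/-- The asymptotic variance of `ℓ(G) + v m`. -/
def asympVar {L : ℕ} (f : ℝ → ℝ) (g : ℝ → EuclideanSpace ℝ (Fin L)) (γ : ℝ)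
    (ℓ : EuclideanSpace ℝ (Fin L) →L[ℝ] ℝ) (v : ℝ) : ℝ :=
  (∫ y, centeredStat f g γ ℓ (y - γ) ^ 2 * f y)
    + (v + ℓ (derivTerm f g γ)) * ℓ (halfDiff f g γ) / f γ
    + (v + ℓ (derivTerm f g γ)) ^ 2 / (4 * f γ ^ 2)

namespace IsRegularModel

variable {L : ℕ} {f : ℝ → ℝ} {g : ℝ → EuclideanSpace ℝ (Fin L)} {γ ε₀ : ℝ} {ζ : ℝ → ℝ}

lemma continuous (R : IsRegularModel f g γ ε₀ ζ) : Continuous f := R.contDiff.continuous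

lemma measurable_comp (R : IsRegularModel f g γ ε₀ ζ) : Measurable fun y => g (y - γ) :=
  R.measurable.comp (measurable_id.sub_const γ)

lemma continuous_deriv (R : IsRegularModel f g γ ε₀ ζ) : Continuous (deriv f) :=
  R.contDiff.continuous_deriv (by norm_num)

lemma integrable (R : IsRegularModel f g γ ε₀ ζ) : Integrable f := by
  refine ⟨R.continuous.aestronglyMeasurable, ?_⟩
  rw [hasFiniteIntegral_iff_ofReal (Eventually.of_forall R.nonneg)]
  have := R.isProbabilityMeasure.measure_univ
  rw [densityLaw, withDensity_apply _ MeasurableSet.univ, Measure.restrict_univ] at this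
  simp [this]

lemma densityLaw_apply (R : IsRegularModel f g γ ε₀ ζ) {s : Set ℝ} (hs : MeasurableSet s) :
    densityLaw f s = ENNReal.ofReal (∫ y in s, f y) := by
  rw [densityLaw, withDensity_apply _ hs, ofReal_integral_eq_lintegral_ofReal
    R.integrable.integrableOn (Eventually.of_forall R.nonneg)]

lemma integral_eq_one (R : IsRegularModel f g γ ε₀ ζ) : ∫ y, f y = 1 := by
  have h := R.densityLaw_apply MeasurableSet.univ
  rw [R.isProbabilityMeasure.measure_univ, setIntegral_univ, eq_comm, ENNReal.ofReal_eq_one] at h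
  exact h

lemma half_le_of_le_densityLaw (R : IsRegularModel f g γ ε₀ ζ) {s : Set ℝ}
    (hs : MeasurableSet s) (h : 1 / 2 ≤ densityLaw f s) : 1 / 2 ≤ ∫ y in s, f y := by
  rw [R.densityLaw_apply hs, show (1 / 2 : ENNReal) = ENNReal.ofReal (1 / 2) by
    rw [ENNReal.ofReal_div_of_pos two_pos]; simp] at h
  exact (ENNReal.ofReal_le_ofReal_iff (setIntegral_nonneg hs fun y _ => R.nonneg y)).1 h

lemma integral_Iic_and_Ioi (R : IsRegularModel f g γ ε₀ ζ) :
    ∫ y in Set.Iic γ, f y = 1 / 2 ∧ ∫ y in Set.Ioi γ, f y = 1 / 2 := by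
  have h1 := R.half_le_of_le_densityLaw measurableSet_Iic R.isMedian.1
  have h2 := R.half_le_of_le_densityLaw measurableSet_Ici R.isMedian.2
  rw [integral_Ici_eq_integral_Ioi] at h2
  have h3 := intervalIntegral.integral_Iic_add_Ioi (b := γ) R.integrable.integrableOn
    R.integrable.integrableOn
  rw [R.integral_eq_one] at h3
  constructor <;> linarith

lemma integrable_norm_sq (R : IsRegularModel f g γ ε₀ ζ) :
    Integrable fun y => ‖g (y - γ)‖ ^ 2 * f y := by
  refine (R.integrable.add R.integrable_cube).mono'
    ((R.measurable_comp.norm.pow_const 2).mul R.continuous.measurable).aestronglyMeasurable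
    (Eventually.of_forall fun y => ?_)
  have h0 := norm_nonneg (g (y - γ))
  rw [Real.norm_of_nonneg (mul_nonneg (by positivity) (R.nonneg y)), Pi.add_apply]
  have h1 : ‖g (y - γ)‖ ^ 2 ≤ 1 + ‖g (y - γ)‖ ^ 3 := by
    nlinarith [mul_nonneg (add_nonneg h0 zero_le_one) (sq_nonneg (‖g (y - γ)‖ - 1))]
  nlinarith [mul_le_mul_of_nonneg_right h1 (R.nonneg y)]

lemma integrable_smul (R : IsRegularModel f g γ ε₀ ζ) : Integrable fun y => f y • g (y - γ) := by
  refine (R.integrable.add R.integrable_norm_sq).mono'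
    (R.continuous.measurable.smul R.measurable_comp).aestronglyMeasurable
    (Eventually.of_forall fun y => ?_)
  rw [norm_smul, Real.norm_of_nonneg (R.nonneg y), Pi.add_apply]
  have h1 : ‖g (y - γ)‖ ≤ 1 + ‖g (y - γ)‖ ^ 2 := by
    nlinarith [sq_nonneg (‖g (y - γ)‖ - 1), sq_nonneg ‖g (y - γ)‖]
  nlinarith [mul_le_mul_of_nonneg_right h1 (R.nonneg y)]

/-- The derivative of `f` is dominated by `ζ`, also after multiplication by `1 + ‖g‖`, up to a
constant factor. -/
lemma bound_mul (R : IsRegularModel f g γ ε₀ ζ) {y a : ℝ} (ha : |a| ≤ ε₀) :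
    |deriv f (y + a)| ≤ ζ y ∧ ‖g (y - γ)‖ * |deriv f (y + a)| ≤ ζ y := by
  have h := R.bound y a ha
  have h0 := norm_nonneg (g (y - γ))
  have h3 : 0 ≤ ‖g (y - γ)‖ ^ 3 := by positivity
  rw [le_div_iff₀ (by positivity)] at h
  have hd := abs_nonneg (deriv f (y + a))
  have h1 : ‖g (y - γ)‖ ≤ 1 + ‖g (y - γ)‖ ^ 3 := by
    nlinarith [mul_nonneg (add_nonneg h0 zero_le_one) (sq_nonneg (‖g (y - γ)‖ - 1))]
  constructor
  · nlinarith
  · nlinarith [mul_le_mul_of_nonneg_right h1 hd]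

lemma integrable_deriv (R : IsRegularModel f g γ ε₀ ζ) : Integrable (deriv f) := by
  refine R.integrable_bound.mono' R.continuous_deriv.aestronglyMeasurable
    (Eventually.of_forall fun y => ?_)
  simpa using (R.bound_mul (y := y) (a := 0) (by simpa using R.eps_pos.le)).1

lemma integrable_deriv_smul (R : IsRegularModel f g γ ε₀ ζ) :
    Integrable fun y => deriv f y • g (y - γ) := by
  refine R.integrable_bound.mono'
    (R.continuous_deriv.measurable.smul R.measurable_comp).aestronglyMeasurable
    (Eventually.of_forall fun y => ?_)
  rw [norm_smul, mul_comm]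
  simpa using (R.bound_mul (y := y) (a := 0) (by simpa using R.eps_pos.le)).2

lemma integral_deriv (R : IsRegularModel f g γ ε₀ ζ) : ∫ y, deriv f y = 0 :=
  integral_eq_zero_of_hasDerivAt_of_integrable
    (fun y => (R.contDiff.differentiable (by norm_num) y).hasDerivAt) R.integrable_deriv
    R.integrable

variable (ℓ : EuclideanSpace ℝ (Fin L) →L[ℝ] ℝ)

lemma measurable_centeredStat (R : IsRegularModel f g γ ε₀ ζ) :
    Measurable (centeredStat f g γ ℓ) :=
  ℓ.continuous.measurable.comp (R.measurable.sub_const _)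

lemma abs_centeredStat_le (z : ℝ) :
    |centeredStat f g γ ℓ z| ≤ ‖ℓ‖ * (‖g z‖ + ‖rho f g γ‖) := by
  rw [← Real.norm_eq_abs]
  exact (ℓ.le_opNorm _).trans (mul_le_mul_of_nonneg_left (norm_sub_le _ _) (norm_nonneg _))

/-- The integral over `s` of the centred statistic against a weight `q`. -/
lemma setIntegral_centeredStat_mul {q : ℝ → ℝ} (hq : Integrable q)
    (hqg : Integrable fun y => q y • g (y - γ)) (s : Set ℝ) :
    ∫ y in s, centeredStat f g γ ℓ (y - γ) * q y
      = ℓ (∫ y in s, q y • g (y - γ)) - (∫ y in s, q y) * ℓ (rho f g γ) := by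
  have h1 : ∀ y, centeredStat f g γ ℓ (y - γ) * q y
      = ℓ (q y • g (y - γ)) - q y * ℓ (rho f g γ) := by
    intro y
    rw [centeredStat, map_sub, map_smul, smul_eq_mul]
    ring
  simp_rw [h1]
  rw [integral_sub (ℓ.integrable_comp hqg.integrableOn) (hq.integrableOn.mul_const _),
    ℓ.integral_comp_comm hqg.integrableOn, integral_mul_const]

lemma integral_centeredStat_mul {q : ℝ → ℝ} (hq : Integrable q)
    (hqg : Integrable fun y => q y • g (y - γ)) :
    ∫ y, centeredStat f g γ ℓ (y - γ) * q y
      = ℓ (∫ y, q y • g (y - γ)) - (∫ y, q y) * ℓ (rho f g γ) := by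
  simpa using setIntegral_centeredStat_mul (f := f) ℓ hq hqg Set.univ

lemma integrable_centeredStat_sq (R : IsRegularModel f g γ ε₀ ζ) :
    Integrable fun y => centeredStat f g γ ℓ (y - γ) ^ 2 * f y := by
  refine ((R.integrable_norm_sq.const_mul (2 * ‖ℓ‖ ^ 2)).add
    (R.integrable.const_mul (2 * ‖ℓ‖ ^ 2 * ‖rho f g γ‖ ^ 2))).mono'
    ((((R.measurable_centeredStat ℓ).comp (measurable_id.sub_const γ)).pow_const 2).mul
      R.continuous.measurable).aestronglyMeasurable (Eventually.of_forall fun y => ?_)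
  rw [Real.norm_of_nonneg (mul_nonneg (by positivity) (R.nonneg y)), Pi.add_apply, ← mul_assoc,
    ← add_mul]
  refine mul_le_mul_of_nonneg_right ?_ (R.nonneg y)
  have h := pow_le_pow_left₀ (abs_nonneg _)
    (abs_centeredStat_le (f := f) (g := g) (γ := γ) ℓ (y - γ)) 2
  rw [sq_abs] at h
  nlinarith [mul_nonneg (sq_nonneg ‖ℓ‖) (sq_nonneg (‖g (y - γ)‖ - ‖rho f g γ‖))]

lemma deriv_comp_add_right (z : ℝ) : deriv (fun z => f (z + γ)) z = deriv f (z + γ) :=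
  deriv_comp_add_const f γ z

/-- The model centred at its median, with the statistic attached to `ℓ`. -/
lemma isCenteredModel (R : IsRegularModel f g γ ε₀ ζ) :
    IsCenteredModel (fun z => f (z + γ)) (centeredStat f g γ ℓ)
      (fun z => (1 + ‖ℓ‖ * (1 + ‖rho f g γ‖)) * ζ (z + γ)) ε₀ where
  nonneg z := R.nonneg _
  contDiff := R.contDiff.comp (contDiff_id.add contDiff_const)
  pos := by simpa using R.pos
  integrable := R.integrable.comp_add_right γ
  integral_Iic := by rw [setIntegral_Iic_add_right f γ, R.integral_Iic_and_Ioi.1]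
  integral_Ioi := by rw [setIntegral_Ioi_add_right f γ, R.integral_Iic_and_Ioi.2]
  measurable := R.measurable_centeredStat ℓ
  eps_pos := R.eps_pos
  integrable_bound := (R.integrable_bound.comp_add_right γ).const_mul _
  bound z a ha := by
    have h := (R.bound_mul (y := z + γ) ha).1
    rw [deriv_comp_add_right, add_right_comm]
    have h0 := (abs_nonneg _).trans h
    have h1 : 0 ≤ ‖ℓ‖ * (1 + ‖rho f g γ‖) := by positivity
    nlinarith [mul_nonneg h1 h0]
  bound_mul z a ha := by
    have h := R.bound_mul (y := z + γ) ha
    rw [add_sub_cancel_right] at h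
    rw [deriv_comp_add_right, add_right_comm]
    have h0 := (abs_nonneg _).trans h.1
    have hd := abs_nonneg (deriv f (z + γ + a))
    calc |centeredStat f g γ ℓ z| * |deriv f (z + γ + a)|
        ≤ ‖ℓ‖ * (‖g z‖ + ‖rho f g γ‖) * |deriv f (z + γ + a)| :=
          mul_le_mul_of_nonneg_right (abs_centeredStat_le ℓ z) hd
      _ = ‖ℓ‖ * (‖g z‖ * |deriv f (z + γ + a)| + ‖rho f g γ‖ * |deriv f (z + γ + a)|) := by ring
      _ ≤ ‖ℓ‖ * (ζ (z + γ) + ‖rho f g γ‖ * ζ (z + γ)) := by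
          gcongr
          exacts [h.2, h.1]
      _ ≤ _ := by linarith
  integrable_sq := by
    have := (R.integrable_centeredStat_sq ℓ).comp_add_right γ
    simpa using this
  centered := by
    have h := integral_add_right_eq_self (μ := volume)
      (fun y => centeredStat f g γ ℓ (y - γ) * f y) γ
    simp only [add_sub_cancel_right] at h
    rw [h, integral_centeredStat_mul ℓ R.integrable R.integrable_smul, R.integral_eq_one, rho]
    simp

lemma integral_centeredStat_mul_deriv (R : IsRegularModel f g γ ε₀ ζ) :
    ∫ z, centeredStat f g γ ℓ z * deriv (fun z => f (z + γ)) z = ℓ (derivTerm f g γ) := by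
  have h := integral_add_right_eq_self (μ := volume)
    (fun y => centeredStat f g γ ℓ (y - γ) * deriv f y) γ
  simp only [add_sub_cancel_right] at h
  simp_rw [deriv_comp_add_right]
  rw [h, integral_centeredStat_mul ℓ R.integrable_deriv R.integrable_deriv_smul,
    R.integral_deriv, derivTerm]
  simp

lemma integral_centeredStat_sq :
    ∫ z, centeredStat f g γ ℓ z ^ 2 * f (z + γ)
      = ∫ y, centeredStat f g γ ℓ (y - γ) ^ 2 * f y := by
  have h := integral_add_right_eq_self (μ := volume)
    (fun y => centeredStat f g γ ℓ (y - γ) ^ 2 * f y) γ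
  simpa only [add_sub_cancel_right] using h

lemma integral_halfSign_centeredStat (R : IsRegularModel f g γ ε₀ ζ) :
    ∫ z, halfSign z * (centeredStat f g γ ℓ z * f (z + γ)) = ℓ (halfDiff f g γ) := by
  have h1 := setIntegral_Ioi_add_right (fun y => centeredStat f g γ ℓ (y - γ) * f y) γ
  have h2 := setIntegral_Iic_add_right (fun y => centeredStat f g γ ℓ (y - γ) * f y) γ
  simp only [add_sub_cancel_right] at h1 h2
  rw [integral_halfSign_mul (R.isCenteredModel ℓ).integrable_mul, h1, h2,
    setIntegral_centeredStat_mul ℓ R.integrable R.integrable_smul,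
    setIntegral_centeredStat_mul ℓ R.integrable R.integrable_smul, R.integral_Iic_and_Ioi.1,
    R.integral_Iic_and_Ioi.2, halfDiff, map_sub, ← integral_Iic_eq_integral_Iio]
  ring

lemma tendsto_integral_medianIntegrand (R : IsRegularModel f g γ ε₀ ζ) (v : ℝ) :
    Tendsto (fun k : ℕ => ((rate k)⁻¹ : ℂ) *
        ∫ x, medianIntegrand (fun z => f (z + γ)) (centeredStat f g γ ℓ) v k x) atTop
      (𝓝 (((Real.pi / (2 * f γ ^ 2) : ℂ) ^ (1 / 2 : ℂ) * f γ) * Complex.exp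
        ((-asympVar f g γ ℓ v / 2 : ℝ) : ℂ))) := by
  have h := (R.isCenteredModel ℓ).tendsto_integral_medianIntegrand v
  rw [R.integral_centeredStat_mul_deriv, integral_centeredStat_sq,
    R.integral_halfSign_centeredStat] at h
  simp only [zero_add] at h
  rw [integral_median_gaussian R.pos] at h
  exact h

/-- The limit of the characteristic functions, in terms of a ratio of median integrals. -/
lemma tendsto_ratio (R : IsRegularModel f g γ ε₀ ζ) (v : ℝ) :
    Tendsto (fun k : ℕ =>
      (∫ x, medianIntegrand (fun z => f (z + γ)) (centeredStat f g γ ℓ) v k x) /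
        ∫ x, medianIntegrand (fun z => f (z + γ)) (centeredStat f g γ 0) 0 k x) atTop
      (𝓝 (Complex.exp ((-asympVar f g γ ℓ v / 2 : ℝ) : ℂ))) := by
  have hq : (f γ : ℂ) ≠ 0 := by exact_mod_cast R.pos.ne'
  have hc : (Real.pi / (2 * f γ ^ 2) : ℂ) ^ (1 / 2 : ℂ) * f γ ≠ 0 := by
    refine mul_ne_zero ?_ hq
    rw [Ne, Complex.cpow_eq_zero_iff]
    rintro ⟨h, -⟩
    rw [div_eq_zero_iff] at h
    rcases h with h | h
    · exact Real.pi_ne_zero (by exact_mod_cast h)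
    · exact mul_ne_zero two_ne_zero (pow_ne_zero 2 hq) h
  have h0 : asympVar f g γ 0 0 = 0 := by simp [asympVar, centeredStat]
  have h := (R.tendsto_integral_medianIntegrand ℓ v).div
    (R.tendsto_integral_medianIntegrand 0 0) (by rw [h0]; simpa using hc)
  rw [h0, mul_div_mul_comm, div_self hc] at h
  simp only [neg_zero, zero_div, Complex.ofReal_zero, Complex.exp_zero, div_one, one_mul] at h
  refine h.congr' ?_
  filter_upwards [eventually_ne_atTop 0] with k hk
  have hr : ((rate k)⁻¹ : ℂ) ≠ 0 := inv_ne_zero (by exact_mod_cast (rate_pos hk).ne')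
  exact mul_div_mul_left _ _ hr

end IsRegularModel

variable {L : ℕ} {f : ℝ → ℝ} {g : ℝ → EuclideanSpace ℝ (Fin L)} {γ ε₀ : ℝ} {ζ : ℝ → ℝ}

/-! ### Characteristic functions and conclusion -/

lemma measurable_normalizedPair (hg : Measurable g) (k : ℕ) :
    Measurable (normalizedPair f g γ k) := by
  refine (WithLp.measurable_toLp 2 _).comp (measurable_pi_lambda _ fun i => ?_)
  have h1 := measurable_medianAdjustedMean hg k
  have h2 := measurable_sampleMedian k
  rcases i with l | _
  · exact (((EuclideanSpace.proj (𝕜 := ℝ) l).continuous.measurable.comp h1).sub_const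
      (rho f g γ l)).const_mul _
  · exact (h2.sub_const γ).const_mul _

/-- The functional on `ℝ^L` given by the first `L` coordinates of `x`. -/
def leftFunctional (x : EuclideanSpace ℝ (Fin L ⊕ Unit)) : EuclideanSpace ℝ (Fin L) →L[ℝ] ℝ :=
  innerSL ℝ (WithLp.toLp 2 fun l => x (Sum.inl l))

lemma leftFunctional_apply (x : EuclideanSpace ℝ (Fin L ⊕ Unit)) (w : EuclideanSpace ℝ (Fin L)) :
    leftFunctional x w = ∑ l, x (Sum.inl l) * w l := by
  simp [leftFunctional, PiLp.inner_apply, mul_comm]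

lemma inner_normalizedPair {k : ℕ} (hk : k ≠ 0) (y : Fin (2 * k + 1) → ℝ)
    (x : EuclideanSpace ℝ (Fin L ⊕ Unit)) :
    inner ℝ (normalizedPair f g γ k y) x
      = x (Sum.inr ()) * ((rate k)⁻¹ * (sampleMedian k y - γ))
        + ∑ j : Fin (2 * k + 1) with j ≠ medianIndex k,
          rate k * centeredStat f g γ (leftFunctional x) (orderStat y j - sampleMedian k y) := by
  have hG : medianAdjustedMean g k y - rho f g γ = rate k ^ 2 •
      ∑ j : Fin (2 * k + 1) with j ≠ medianIndex k,
        (g (orderStat y j - sampleMedian k y) - rho f g γ) := by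
    have hcard : (Finset.univ.filter fun j : Fin (2 * k + 1) => j ≠ medianIndex k).card
        = 2 * k := by
      rw [Finset.filter_ne', Finset.card_erase_of_mem (Finset.mem_univ _), Finset.card_univ,
        Fintype.card_fin, Nat.add_sub_cancel]
    have hk' : (2 * (k : ℝ)) ≠ 0 := by positivity
    rw [Finset.sum_sub_distrib, Finset.sum_const, hcard, smul_sub, rate_sq, medianAdjustedMean,
      one_div, ← Nat.cast_smul_eq_nsmul ℝ, smul_smul]
    push_cast
    rw [inv_mul_cancel₀ hk', one_smul]
  have hr := (rate_pos hk).ne'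
  have hsqrt : √(2 * (k : ℝ)) = (rate k)⁻¹ := by rw [rate, inv_inv]
  have h1 : inner ℝ (normalizedPair f g γ k y) x
      = (rate k)⁻¹ * leftFunctional x (medianAdjustedMean g k y - rho f g γ)
        + x (Sum.inr ()) * ((rate k)⁻¹ * (sampleMedian k y - γ)) := by
    rw [leftFunctional_apply, PiLp.inner_apply, Fintype.sum_sum_type, Finset.mul_sum, ← hsqrt]
    simp [normalizedPair, mul_left_comm]
  rw [h1, hG, map_smul, map_sum, smul_eq_mul, ← mul_assoc, sq, ← mul_assoc,
    inv_mul_cancel₀ hr, one_mul, Finset.mul_sum, add_comm]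
  rfl

lemma cexp_inner_normalizedPair {k : ℕ} (hk : k ≠ 0) (y : Fin (2 * k + 1) → ℝ)
    (x : EuclideanSpace ℝ (Fin L ⊕ Unit)) :
    Complex.exp (inner ℝ (normalizedPair f g γ k y) x * Complex.I)
      = Complex.exp (Complex.I *
          ((x (Sum.inr ()) * ((rate k)⁻¹ * (sampleMedian k y - γ)) : ℝ) : ℂ)) *
        ∏ j : Fin (2 * k + 1) with j ≠ medianIndex k,
          expI (centeredStat f g γ (leftFunctional x)) (rate k)
            (orderStat y j - sampleMedian k y) := by
  rw [inner_normalizedPair hk, mul_comm _ Complex.I, Complex.ofReal_add, mul_add, Complex.exp_add,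
    Complex.ofReal_sum, Finset.mul_sum, Complex.exp_sum]
  rfl

lemma integral_belowPart_densityLaw (hf : Measurable f) (hf0 : ∀ y, 0 ≤ f y) (h : ℝ → ℂ) (x : ℝ) :
    ∫ z, belowPart h (x + γ) z ∂densityLaw f = lowerPart (fun z => f (z + γ)) h x := by
  rw [integral_densityLaw hf hf0, lowerPart,
    ← integral_add_right_eq_self (fun y => f y • belowPart h (x + γ) y) (x + γ)]
  refine integral_congr_ae (Eventually.of_forall fun z => ?_)
  simp [belowPart, mul_comm, add_assoc]

lemma integral_abovePart_densityLaw (hf : Measurable f) (hf0 : ∀ y, 0 ≤ f y) (h : ℝ → ℂ) (x : ℝ) :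
    ∫ z, abovePart h (x + γ) z ∂densityLaw f = upperPart (fun z => f (z + γ)) h x := by
  rw [integral_densityLaw hf hf0, upperPart,
    ← integral_add_right_eq_self (fun y => f y • abovePart h (x + γ) y) (x + γ)]
  refine integral_congr_ae (Eventually.of_forall fun z => ?_)
  simp [abovePart, mul_comm, add_assoc]

variable {Ω : Type*} [MeasurableSpace Ω] {P : Measure Ω} {Y : ℕ → Ω → ℝ}

lemma hasLaw_sample (hY_law : ∀ j, HasLaw (Y j) (densityLaw f) P) (hY_indep : iIndepFun Y P)
    (n : ℕ) :
    HasLaw (fun ω (j : Fin n) => Y j ω) (Measure.pi fun _ : Fin n => densityLaw f) P :=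
  iIndepFun.hasLaw_pi (fun j : Fin n => hY_law j)
    (hY_indep.precomp (g := fun j : Fin n => (j : ℕ)) Fin.val_injective)

/-- The characteristic function of the normalised pair is a median integral, up to a factor that
depends on the sample size only. -/
lemma charFun_normalizedPair (R : IsRegularModel f g γ ε₀ ζ)
    (hY_law : ∀ j, HasLaw (Y j) (densityLaw f) P) (hY_indep : iIndepFun Y P) {k : ℕ}
    (hk : k ≠ 0) (x : EuclideanSpace ℝ (Fin L ⊕ Unit)) :
    charFun (P.map fun ω => normalizedPair f g γ k fun j : Fin (2 * k + 1) => Y j ω) x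
      = (((2 * k + 1 : ℕ) * (2 * k).choose k : ℂ) / 4 ^ k) *
        ∫ z, medianIntegrand (fun z => f (z + γ)) (centeredStat f g γ (leftFunctional x))
          (x (Sum.inr ())) k z := by
  have := R.isProbabilityMeasure
  have hlaw := hasLaw_sample hY_law hY_indep (2 * k + 1)
  have hnp := measurable_normalizedPair (f := f) (γ := γ) R.measurable k
  have hmap : (P.map fun ω => normalizedPair f g γ k fun j : Fin (2 * k + 1) => Y j ω)
      = (Measure.pi fun _ : Fin (2 * k + 1) => densityLaw f).map (normalizedPair f g γ k) := by
    rw [← hlaw.map_eq, AEMeasurable.map_map_of_aemeasurable hnp.aemeasurable hlaw.aemeasurable]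
    rfl
  have hmeas : Measurable fun w : EuclideanSpace ℝ (Fin L ⊕ Unit) =>
      Complex.exp (inner ℝ w x * Complex.I) := by fun_prop
  rw [hmap, charFun_apply, integral_map hnp.aemeasurable hmeas.aestronglyMeasurable]
  simp_rw [cexp_inner_normalizedPair hk]
  have hf := R.continuous.measurable
  rw [integral_median_prod (densityLaw f)
    (e := fun m => Complex.exp (Complex.I *
      ((x (Sum.inr ()) * ((rate k)⁻¹ * (m - γ)) : ℝ) : ℂ)))
    (h := expI (centeredStat f g γ (leftFunctional x)) (rate k)) (by fun_prop)
    (measurable_expI (R.measurable_centeredStat _) _)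
    (fun z => (Complex.norm_exp_I_mul_ofReal _).le) (fun z => (norm_expI _ _ z).le) k,
    integral_densityLaw hf R.nonneg, div_mul_eq_mul_div, mul_div_assoc]
  congr 1
  rw [← integral_add_right_eq_self _ γ, ← integral_div]
  refine integral_congr_ae (Eventually.of_forall fun z => ?_)
  simp only
  rw [integral_belowPart_densityLaw hf R.nonneg, integral_abovePart_densityLaw hf R.nonneg,
    medianIntegrand, add_sub_cancel_right, Complex.real_smul, mul_pow (4 : ℂ), ← mul_pow]
  field_simp

variable [IsProbabilityMeasure P]

lemma tendsto_charFun_normalizedPair (R : IsRegularModel f g γ ε₀ ζ)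
    (hY_law : ∀ j, HasLaw (Y j) (densityLaw f) P) (hY_indep : iIndepFun Y P)
    (x : EuclideanSpace ℝ (Fin L ⊕ Unit)) :
    Tendsto (fun k : ℕ =>
        charFun (P.map fun ω => normalizedPair f g γ k fun j : Fin (2 * k + 1) => Y j ω) x) atTop
      (𝓝 (Complex.exp
        ((-asympVar f g γ (leftFunctional x) (x (Sum.inr ())) / 2 : ℝ) : ℂ))) := by
  refine (R.tendsto_ratio (leftFunctional x) (x (Sum.inr ()))).congr' ?_
  filter_upwards [eventually_ne_atTop 0] with k hk
  have hx := charFun_normalizedPair R hY_law hY_indep hk x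
  have h0 := charFun_normalizedPair R hY_law hY_indep hk 0
  have hlaw := hasLaw_sample hY_law hY_indep (2 * k + 1)
  have hae : AEMeasurable (fun ω => normalizedPair f g γ k fun j : Fin (2 * k + 1) => Y j ω) P :=
    (measurable_normalizedPair R.measurable k).comp_aemeasurable hlaw.aemeasurable
  have := Measure.isProbabilityMeasure_map hae
  have hl0 : leftFunctional (0 : EuclideanSpace ℝ (Fin L ⊕ Unit)) = 0 := by
    ext w
    simp [leftFunctional_apply]
  rw [charFun_zero, probReal_univ, hl0] at h0
  simp only [PiLp.zero_apply, Complex.ofReal_one] at h0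
  have hK0 := right_ne_zero_of_mul (h0.symm ▸ one_ne_zero :
    (((2 * k + 1 : ℕ) * (2 * k).choose k : ℂ) / 4 ^ k) *
      (∫ z, medianIntegrand (fun z => f (z + γ)) (centeredStat f g γ 0) 0 k z) ≠ 0)
  rw [hx, div_eq_iff hK0, mul_assoc, mul_comm (∫ z, _) (∫ z, _), ← mul_assoc, ← h0, one_mul]

/-- The quadratic form of the asymptotic covariance matrix. -/
lemma dotProduct_asympCov_mulVec (R : IsRegularModel f g γ ε₀ ζ)
    (x : EuclideanSpace ℝ (Fin L ⊕ Unit)) :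
    x.ofLp ⬝ᵥ (asympCov f g γ).mulVec x.ofLp
      = asympVar f g γ (leftFunctional x) (x (Sum.inr ())) := by
  set u : Fin L → ℝ := fun l => x (Sum.inl l) with hu
  set v : ℝ := x (Sum.inr ())
  set r := rho f g γ
  have hint : ∀ i j, Integrable fun y => (g (y - γ) i - r i) * (g (y - γ) j - r j) * f y := by
    intro i j
    have h := fun l : EuclideanSpace ℝ (Fin L) →L[ℝ] ℝ => R.integrable_centeredStat_sq l
    have h1 := ((h (EuclideanSpace.proj i + EuclideanSpace.proj j)).sub
      (h (EuclideanSpace.proj i - EuclideanSpace.proj j))).const_mul (1 / 4)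
    refine h1.congr (Eventually.of_forall fun y => ?_)
    simp [centeredStat, r]
    ring
  have hsq : ∫ y, centeredStat f g γ (leftFunctional x) (y - γ) ^ 2 * f y
      = ∑ i, ∑ j, u i * u j * ∫ y, (g (y - γ) i - r i) * (g (y - γ) j - r j) * f y := by
    have h1 : ∀ y, centeredStat f g γ (leftFunctional x) (y - γ) ^ 2 * f y
        = ∑ i, ∑ j, u i * u j * ((g (y - γ) i - r i) * (g (y - γ) j - r j) * f y) := by
      intro y
      rw [centeredStat, leftFunctional_apply, sq, Finset.sum_mul_sum, Finset.sum_mul]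
      refine Finset.sum_congr rfl fun i _ => ?_
      rw [Finset.sum_mul]
      refine Finset.sum_congr rfl fun j _ => ?_
      simp only [PiLp.sub_apply, hu, r]
      ring
    simp_rw [h1]
    rw [integral_finsetSum _ fun i _ => integrable_finsetSum _ fun j _ =>
      (hint i j).const_mul _]
    refine Finset.sum_congr rfl fun i _ => ?_
    rw [integral_finsetSum _ fun j _ => (hint i j).const_mul _]
    simp_rw [integral_const_mul]
  have hd := leftFunctional_apply x (derivTerm f g γ)
  have hh := leftFunctional_apply x (halfDiff f g γ)
  have hq : f γ ≠ 0 := R.pos.ne'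
  have h11 : ∑ i, ∑ j, u i * (Sigma11 f g γ i j * u j)
      = (∑ i, ∑ j, u i * u j * ∫ y, (g (y - γ) i - r i) * (g (y - γ) j - r j) * f y)
        + 1 / (4 * f γ ^ 2) *
          ((leftFunctional x (derivTerm f g γ)) * (leftFunctional x (derivTerm f g γ)))
        + 1 / (2 * f γ) *
          ((leftFunctional x (derivTerm f g γ)) * (leftFunctional x (halfDiff f g γ)))
        + 1 / (2 * f γ) *
          ((leftFunctional x (halfDiff f g γ)) * (leftFunctional x (derivTerm f g γ))) := by
    rw [hd, hh, Finset.sum_mul_sum, Finset.sum_mul_sum, Finset.sum_mul_sum]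
    simp only [Finset.mul_sum, ← Finset.sum_add_distrib]
    refine Finset.sum_congr rfl fun i _ => Finset.sum_congr rfl fun j _ => ?_
    simp only [Sigma11, Matrix.of_apply, hu, r]
    ring
  have h12 : ∑ i, u i * (Sigma12 f g γ i () * v)
      = (1 / (2 * f γ) * leftFunctional x (halfDiff f g γ)
        + 1 / (4 * f γ ^ 2) * leftFunctional x (derivTerm f g γ)) * v := by
    rw [hd, hh]
    simp only [Finset.mul_sum, ← Finset.sum_add_distrib, Finset.sum_mul]
    refine Finset.sum_congr rfl fun i _ => ?_
    simp only [Sigma12, Matrix.of_apply, hu]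
    ring
  have hexp : x.ofLp ⬝ᵥ (asympCov f g γ).mulVec x.ofLp
      = (∑ i, ∑ j, u i * (Sigma11 f g γ i j * u j))
        + 2 * (∑ i, u i * (Sigma12 f g γ i () * v)) + v * (Sigma22 f γ () () * v) := by
    rw [asympCov, Matrix.fromBlocks_mulVec, dotProduct, Fintype.sum_sum_type]
    simp only [Sum.elim_inl, Sum.elim_inr, Matrix.mulVec, dotProduct, Pi.add_apply,
      Function.comp_apply, Fintype.sum_unique, Matrix.transpose_apply, mul_add,
      Finset.sum_add_distrib, Finset.mul_sum, PUnit.default_eq_unit]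
    have hcomm : ∑ i, v * (Sigma12 f g γ i () * u i) = ∑ i, u i * (Sigma12 f g γ i () * v) :=
      Finset.sum_congr rfl fun i _ => by ring
    change (∑ i, ∑ j, u i * (Sigma11 f g γ i j * u j)) + (∑ i, u i * (Sigma12 f g γ i () * v))
      + ((∑ i, v * (Sigma12 f g γ i () * u i)) + v * (Sigma22 f γ () () * v)) = _
    rw [hcomm, ← Finset.mul_sum]
    ring
  rw [hexp, h11, h12, asympVar, hsq, Sigma22, Matrix.of_apply]
  field_simp
  ring

lemma posSemidef_asympCov (R : IsRegularModel f g γ ε₀ ζ)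
    (hY_law : ∀ j, HasLaw (Y j) (densityLaw f) P) (hY_indep : iIndepFun Y P) :
    (asympCov f g γ).PosSemidef := by
  refine Matrix.PosSemidef.of_dotProduct_mulVec_nonneg ?_ fun x => ?_
  · refine Matrix.IsHermitian.fromBlocks ?_ ?_ ?_
    · ext i j
      simp only [Sigma11, Matrix.conjTranspose_apply, Matrix.of_apply, star_trivial]
      have : ∀ y, (g (y - γ) j - rho f g γ j) * (g (y - γ) i - rho f g γ i) * f y
          = (g (y - γ) i - rho f g γ i) * (g (y - γ) j - rho f g γ j) * f y := fun y => by ring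
      simp_rw [this]
      ring
    · rw [Matrix.conjTranspose_eq_transpose_of_trivial]
    · ext i j
      simp [Sigma22]
  · have h := tendsto_charFun_normalizedPair R hY_law hY_indep (WithLp.toLp 2 x)
    have hle := le_of_tendsto h.norm (Eventually.of_forall fun k => by
      have hae : AEMeasurable (fun ω => normalizedPair f g γ k
          fun j : Fin (2 * k + 1) => Y j ω) P :=
        (measurable_normalizedPair R.measurable k).comp_aemeasurable
          (hasLaw_sample hY_law hY_indep (2 * k + 1)).aemeasurable
      have := Measure.isProbabilityMeasure_map hae
      exact norm_charFun_le_one _)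
    rw [← dotProduct_asympCov_mulVec R, Complex.norm_exp_ofReal, Real.exp_le_one_iff] at hle
    simp only [star_trivial] at hle ⊢
    linarith

end MedianCLT

end

theorem mainTheorem2 {Ω : Type*} [MeasurableSpace Ω] (P : Measure Ω) [IsProbabilityMeasure P]
    {L : ℕ} (Y : ℕ → Ω → ℝ) (f : ℝ → ℝ) (g : ℝ → EuclideanSpace ℝ (Fin L))
    (γ ε₀ : ℝ) (ζ : ℝ → ℝ)
    (hf_nonneg : ∀ y, 0 ≤ f y)
    (hY_law : ∀ j, HasLaw (Y j) (MedianCLT.densityLaw f) P)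
    (hY_indep : iIndepFun Y P)
    (hg : Measurable g)
    (hf : ContDiff ℝ 1 f)
    (hγ : ∀ c, MedianCLT.IsMedian (MedianCLT.densityLaw f) c ↔ c = γ)
    (hfγ : 0 < f γ)
    (hε₀ : 0 < ε₀)
    (hζ : Integrable ζ)
    (hdom : ∀ y a : ℝ, |a| ≤ ε₀ → |deriv f (y + a)| ≤ ζ y / (1 + ‖g (y - γ)‖ ^ 3))
    (hg3 : Integrable fun y => ‖g (y - γ)‖ ^ 3 * f y) :
    (Integrable (fun y => f y • g (y - γ)) ∧
      Integrable (fun y => ‖g (y - γ)‖ ^ 2 * f y) ∧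
      Integrable (fun y => deriv f y • g (y - γ))) ∧
    (MedianCLT.asympCov f g γ).PosSemidef ∧
    TendstoInDistribution
      (fun (k : ℕ) (ω : Ω) =>
        MedianCLT.normalizedPair f g γ k (fun j : Fin (2 * k + 1) => Y j ω))
      atTop id (fun _ => P)
      (multivariateGaussian (0 : EuclideanSpace ℝ (Fin L ⊕ Unit))
        (MedianCLT.asympCov f g γ)) := by
  have R : MedianCLT.IsRegularModel f g γ ε₀ ζ :=
    ⟨hf_nonneg, (hY_law 0).isProbabilityMeasure_iff.1 inferInstance, hg, hf, (hγ γ).2 rfl, hfγ,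
      hε₀, hζ, hdom, hg3⟩
  have hpsd := MedianCLT.posSemidef_asympCov R hY_law hY_indep
  refine ⟨⟨R.integrable_smul, R.integrable_norm_sq, R.integrable_deriv_smul⟩, hpsd, ?_⟩
  refine ⟨fun k => (MedianCLT.measurable_normalizedPair hg k).comp_aemeasurable
    (MedianCLT.hasLaw_sample hY_law hY_indep (2 * k + 1)).aemeasurable, aemeasurable_id, ?_⟩
  refine ProbabilityMeasure.tendsto_iff_tendsto_charFun.2 fun x => ?_
  simp only [ProbabilityMeasure.coe_mk, Measure.map_id]
  rw [charFun_multivariateGaussian hpsd, MedianCLT.dotProduct_asympCov_mulVec R, inner_zero_right]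
  have h := MedianCLT.tendsto_charFun_normalizedPair R hY_law hY_indep x
  convert h using 2
  push_cast
  congr 1
  ring
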